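/- Let $q$ be a prime power and $n\ge 2$. Let $\Gamma\mathrm{L}_n(q)$ be the group of bijective semilinear maps of $\mathbb F_q^n$, let $Z$ be its subgroup of nonzero scalar maps, let $\mathrm{P\Gamma L}_n(q)=\Gamma\mathrm{L}_n(q)/Z$, let $\mathrm{PGL}_n(q)$ and $\mathrm{PSL}_n(q)$ be the images in $\mathrm{P\Gamma L}_n(q)$ of $\mathrm{GL}_n(q)$ and $\mathrm{SL}_n(q)$, and let $\mathrm{P\Sigma L}_n(q)$ be the image of the group generated by $\mathrm{SL}_n(q)$ and the field automorphisms acting on coordinates. All these groups act on the set $\Omega_1$ of $1$-dimensional subspaces of $\mathbb F_q^n$. For a group $G$ acting on a set $\Omega$, two $k$-tuples $X=(x_1,\dots,x_k)$ and $Y=(y_1,\dots,y_k)$ in $\Omega^k$ are $r$-equivalent under $G$ ($r\le k$) if for every $r$-subset $\{i_1,\dots,i_r\}$ of $\{1,\dots,k\}$ there is $g\in G$ mapping $x_{i_j}$ to $y_{i_j}$ for all $j$. The relational complexity $\mathrm{RC}(G,\Omega)$ is the smallest $r\ge 1$ such that, for all $k\ge r$, any two $r$-equivalent $k$-tuples lie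 in the same $G$-orbit on $\Omega^k$. Let $\omega(k)$ be the number of distinct prime divisors of $k$. Theorem. Let $\mathrm{PSL}_n(q)\le G\le \mathrm{P\Gamma L}_n(q)$, let $e=|G:G\cap \mathrm{PGL}_n(q)|$, and suppose that $e>1$. (i) If $n=2$ and $q\ge 8$, then $4\le \mathrm{RC}(G,\Omega_1)\le 4+\omega(e)$, except that $\mathrm{RC}(\mathrm{P\Sigma L}_2(9),\Omega_1)=3$. (ii) If $n\ge 3$, then $n+2\le \mathrm{RC}(G,\Omega_1)\le 2n-1+\omega(e)$. Moreover $\mathrm{RC}(G,\Omega_1)\ge n+3$ if $\mathrm{PGL}_n(q)<G$, and $\mathrm{RC}(G,\Omega_1)\ge 2n-2$ if $G\le \mathrm{P\Sigma L}_n(q)\ne \mathrm{P\Gamma L}_n(q)$. -/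

import Mathlib

open scoped LinearAlgebra.Projectivization

/-! ### Relational complexity of a group action -/

section RelationalComplexity

variable (G : Type*) {Ω : Type*} [Group G] [MulAction G Ω]

/-- `r`-equivalence of `k`-tuples: each `r`-subset of the entries of `X` can be moved
simultaneously to the corresponding entries of `Y` by some element of `G`. -/
def REquiv (r : ℕ) {k : ℕ} (X Y : Fin k → Ω) : Prop :=
  ∀ I : Finset (Fin k), I.card = r → ∃ g : G, ∀ i ∈ I, g • X i = Y i

/-- Equivalence of `k`-tuples: they lie in the same `G`-orbit. -/
def TupleEquiv {k : ℕ} (X Y : Fin k → Ω) : Prop :=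
  ∃ g : G, ∀ i, g • X i = Y i

variable (Ω) in
/-- The relational complexity `RC(G, Ω)`: the smallest `r ≥ 1` such that `r`-equivalence of
`k`-tuples implies their equivalence, for all `k ≥ r` (it is `⊤` if there is no such `r`). -/
noncomputable def relationalComplexity : ℕ∞ :=
  sInf {c : ℕ∞ | ∃ r : ℕ, c = r ∧ 1 ≤ r ∧
    ∀ k : ℕ, r ≤ k → ∀ X Y : Fin k → Ω, REquiv G r X Y → TupleEquiv G X Y}

end RelationalComplexity

/-! ### Semilinear groups and their projective versions -/

section Semilinear

variable (K : Type*) [Field K]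

section General

variable (V : Type*) [AddCommGroup V] [Module K V]

/-- The group `ΓL(V)` of all bijective semilinear maps `V → V`, with composition. -/
def GammaL : Subgroup (Equiv.Perm V) where
  carrier := {f | (∀ u v : V, f (u + v) = f u + f v) ∧
    ∃ σ : K ≃+* K, ∀ (c : K) (v : V), f (c • v) = σ c • f v}
  one_mem' := ⟨fun _ _ => rfl, RingEquiv.refl K, fun _ _ => rfl⟩
  mul_mem' := by
    rintro f g ⟨hf, σ, hσ⟩ ⟨hg, τ, hτ⟩
    refine ⟨fun u v => ?_, τ.trans σ, fun c v => ?_⟩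
    · change f (g (u + v)) = f (g u) + f (g v)
      rw [hg, hf]
    · change f (g (c • v)) = σ (τ c) • f (g v)
      rw [hτ, hσ]
  inv_mem' := by
    rintro f ⟨hf, σ, hσ⟩
    refine ⟨fun u v => ?_, σ.symm, fun c v => ?_⟩
    · change f.symm (u + v) = f.symm u + f.symm v
      apply f.injective
      rw [hf, Equiv.apply_symm_apply, Equiv.apply_symm_apply, Equiv.apply_symm_apply]
    · change f.symm (c • v) = σ.symm c • f.symm v
      apply f.injective
      rw [hσ, Equiv.apply_symm_apply, Equiv.apply_symm_apply, RingEquiv.apply_symm_apply]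

variable {K V} in
theorem GammaL.map_ne_zero (f : GammaL K V) {v : V} (hv : v ≠ 0) : f.1 v ≠ 0 := by
  obtain ⟨hf, -⟩ := f.2
  have h0 : f.1 0 = 0 := by simpa using hf 0 0
  exact fun h => hv (f.1.injective (h.trans h0.symm))

/-- The inclusion of the linear automorphisms of `V` into `ΓL(V)`. -/
def linearToGammaL : (V ≃ₗ[K] V) →* GammaL K V where
  toFun f := ⟨f.toEquiv, fun u v => map_add f u v, RingEquiv.refl K, fun c v => map_smul f c v⟩
  map_one' := rfl
  map_mul' _ _ := rfl

/-- The group `Z` of scalar maps `v ↦ c • v` with `c ≠ 0`, as a subgroup of `ΓL(V)`. -/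
def scalarGL : Subgroup (GammaL K V) where
  carrier := {f | ∃ c : Kˣ, ∀ v : V, f.1 v = c • v}
  one_mem' := ⟨1, fun v => (one_smul Kˣ v).symm⟩
  mul_mem' := by
    rintro f g ⟨a, ha⟩ ⟨b, hb⟩
    refine ⟨a * b, fun v => ?_⟩
    change f.1 (g.1 v) = (a * b) • v
    rw [hb, ha, mul_smul]
  inv_mem' := by
    rintro f ⟨a, ha⟩
    refine ⟨a⁻¹, fun v => ?_⟩
    change f.1.symm v = a⁻¹ • v
    apply f.1.injective
    rw [Equiv.apply_symm_apply, ha, smul_inv_smul]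

instance scalarGL_normal : (scalarGL K V).Normal where
  conj_mem := by
    rintro f ⟨a, ha⟩ g
    obtain ⟨-, σ, hσ⟩ := g.2
    refine ⟨Units.map (σ : K →* K) a, fun v => ?_⟩
    change g.1 (f.1 (g.1.symm v)) = _
    rw [ha, Units.smul_def, hσ, Equiv.apply_symm_apply]
    rfl

/-- The natural action of `ΓL(V)` on the set of 1-dimensional subspaces of `V`:
`f` maps the span of `v` to the span of `f v`. -/
instance gammaLAction : MulAction (GammaL K V) (ℙ K V) where
  smul f := Quotient.map'
    (fun v => ⟨f.1 v.1, GammaL.map_ne_zero f v.2⟩) (by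
      rintro ⟨u, hu⟩ ⟨v, hv⟩ ⟨a, ha⟩
      obtain ⟨-, σ, hσ⟩ := f.2
      refine ⟨Units.map (σ : K →* K) a, ?_⟩
      change σ a • f.1 v = f.1 u
      rw [← hσ]
      exact congrArg f.1 ha)
  one_smul := by rintro ⟨v⟩; rfl
  mul_smul := by rintro f g ⟨v⟩; rfl

theorem gammaL_smul_mk (f : GammaL K V) (v : V) (hv : v ≠ 0) :
    f • Projectivization.mk K v hv =
      Projectivization.mk K (f.1 v) (GammaL.map_ne_zero f hv) := rfl

theorem scalarGL_le_ker : scalarGL K V ≤ (MulAction.toPermHom (GammaL K V) (ℙ K V)).ker := by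
  rintro f ⟨a, ha⟩
  rw [MonoidHom.mem_ker]
  ext x
  induction x using Projectivization.ind with
  | h v hv =>
    change f • Projectivization.mk K v hv = Projectivization.mk K v hv
    rw [gammaL_smul_mk, Projectivization.mk_eq_mk_iff]
    exact ⟨a, (ha v).symm⟩

/-- The projective semilinear group `PΓL(V) = ΓL(V) / Z`. -/
abbrev PGammaL : Type _ := GammaL K V ⧸ scalarGL K V

/-- The action of `PΓL(V)` on the set of 1-dimensional subspaces of `V`, induced by that
of `ΓL(V)`. -/
instance pGammaLAction : MulAction (PGammaL K V) (ℙ K V) :=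
  MulAction.compHom (ℙ K V)
    (QuotientGroup.lift (scalarGL K V) (MulAction.toPermHom (GammaL K V) (ℙ K V))
      (scalarGL_le_ker K V))

theorem pGammaL_smul (f : GammaL K V) (x : ℙ K V) : (f : PGammaL K V) • x = f • x := rfl

/-- `PGL(V)`, the image of `GL(V)` in `PΓL(V)`. -/
def PGL : Subgroup (PGammaL K V) :=
  ((linearToGammaL K V).range).map (QuotientGroup.mk' (scalarGL K V))

/-- `SL(V)`, the linear automorphisms of determinant one, as a subgroup of `ΓL(V)`. -/
noncomputable def SLGamma : Subgroup (GammaL K V) :=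
  ((LinearEquiv.det : (V ≃ₗ[K] V) →* Kˣ).ker).map (linearToGammaL K V)

/-- `PSL(V)`, the image of `SL(V)` in `PΓL(V)`. -/
noncomputable def PSL : Subgroup (PGammaL K V) :=
  (SLGamma K V).map (QuotientGroup.mk' (scalarGL K V))

end General

variable (n : ℕ)

/-- The semilinear maps of `K^n` that apply a field automorphism to every coordinate. -/
def fieldAutToGammaL : (K ≃+* K) →* GammaL K (Fin n → K) where
  toFun σ := ⟨Equiv.piCongrRight fun _ => σ.toEquiv,
    fun u v => funext fun i => map_add σ (u i) (v i),
    σ, fun c v => funext fun i => map_mul σ c (v i)⟩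
  map_one' := rfl
  map_mul' _ _ := rfl

/-- `PΣL_n(K)`, the image in `PΓL_n(K)` of the group `ΣL_n(K)` generated by `SL_n(K)` and
the field automorphisms acting on coordinates. -/
noncomputable def PSigmaL : Subgroup (PGammaL K (Fin n → K)) :=
  (SLGamma K (Fin n → K) ⊔ (fieldAutToGammaL K n).range).map
    (QuotientGroup.mk' (scalarGL K (Fin n → K)))

end Semilinear

/-! ### General bounds for the relational complexity -/

section GeneralBounds

variable {G Ω ι : Type*} [Group G] [MulAction G Ω]

/-! Upper bounds. A tuple has the same pointwise stabilizer as some independent subtuple, so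
relational complexity is at most one more than the largest size of an independent set
(`relationalComplexity_le_of_isIndependentOn`). The kernel of the map from `G` to field
automorphisms consists of linear maps, and the image is cyclic of order `e`. An independent set for
`G` splits into one for the kernel and a remainder whose points need different primes dividing `e`
(`IsIndependentOn.card_le_add`). For linear groups, a basis is chosen among the points. Each other
point has a witnessing map, diagonal in that basis; the diagonals of these maps, together with the
constant function, are linearly independent. This gives at most `2n - 1` points, and for `n ≥ 3`
equality is impossible (`card_le_of_independent_points`).

Lower bounds. It suffices to exhibit two `k`-tuples that are not equivalent but become so after
deleting any one entry. A map fixing a projective frame is a scalar times a field automorphism, so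
extra points added to a frame record field elements. With two such parameters, a pair `(ζ, ζ)` is
compared with `(ζ, τ ζ)`: either parameter can be altered once a suitable point is omitted, but no
automorphism realizes both values (`card_add_three_le_relationalComplexity`). When only `PSL` is
available, one spare coordinate absorbs determinants, at the cost of one point. For `G ≤ PΣL` the
obstruction is instead the determinant modulo `n`-th powers
(`two_mul_sub_two_le_relationalComplexity`).

Small dimensions need more. For `n = 3` there is no spare coordinate to use. Five-point tuples built
from a cube root of unity either give the bound or put so many conjugates of field automorphisms
into `G` that commutators force `PGL ≤ G` (`PGL_le_or_five_le_relationalComplexity`). For `n = 2`, a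
count of square classes gives two non-conjugate cross-ratios that `PSL` cannot separate on triples,
except over nine elements. There the quadratic character of a product of determinants is an
invariant of triples, and it determines `PΣL`-orbits of tuples
(`relationalComplexity_PSigmaL_le_three`). -/

theorem card_le_relationalComplexity [Fintype ι] (X Y : ι → Ω)
    (h : ∀ i₀, ∃ g : G, ∀ i, i ≠ i₀ → g • X i = Y i) (hne : ¬ ∃ g : G, ∀ i, g • X i = Y i) :
    (Fintype.card ι : ℕ∞) ≤ relationalComplexity G Ω := by
  refine le_sInf ?_
  rintro c ⟨r, rfl, -, H⟩
  by_contra hlt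
  have hlt : r < Fintype.card ι := by exact_mod_cast not_le.mp hlt
  let eqv := Fintype.equivFin ι
  obtain ⟨g, hg⟩ := H (Fintype.card ι) hlt.le (X ∘ eqv.symm) (Y ∘ eqv.symm) (by
    intro I hI
    obtain ⟨i₀, hi₀⟩ : ∃ i₀, i₀ ∉ I := by
      by_contra hall
      push Not at hall
      have : I = Finset.univ := Finset.eq_univ_iff_forall.mpr hall
      rw [this, Finset.card_fin] at hI
      omega
    obtain ⟨g, hg⟩ := h (eqv.symm i₀)
    refine ⟨g, fun i hi => hg _ fun hii => hi₀ ?_⟩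
    rwa [← eqv.symm.injective hii])
  exact hne ⟨g, fun i => by simpa using hg (eqv i)⟩

theorem relationalComplexity_le (r : ℕ) (hr : 1 ≤ r)
    (H : ∀ k : ℕ, r ≤ k → ∀ X Y : Fin k → Ω, REquiv G r X Y → TupleEquiv G X Y) :
    relationalComplexity G Ω ≤ r :=
  sInf_le ⟨r, rfl, hr, H⟩

theorem REquiv.exists_smul_eq {r k : ℕ} {X Y : Fin k → Ω} (h : REquiv G r X Y) (hrk : r ≤ k)
    (I : Finset (Fin k)) (hI : I.card ≤ r) : ∃ g : G, ∀ i ∈ I, g • X i = Y i := by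
  obtain ⟨J, hIJ, hJ⟩ := Finset.exists_superset_card_eq hI (by simpa using hrk)
  obtain ⟨g, hg⟩ := h J hJ
  exact ⟨g, fun i hi => hg i (hIJ hi)⟩

variable (G) in
/-- The entries of `x` indexed by `C` form an independent set for `G`: each of them is moved
by an element of `G` that fixes all the others. -/
def IsIndependentOn (x : ι → Ω) (C : Finset ι) : Prop :=
  ∀ i ∈ C, ∃ g : G, (∀ j ∈ C, j ≠ i → g • x j = x j) ∧ g • x i ≠ x i

variable (G) in
-- If some point is fixed by everything that fixes the others, deleting it leaves the pointwise
-- stabilizer unchanged; repeat until no such point is left.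
theorem exists_isIndependentOn_subset (x : ι → Ω) (s : Finset ι) :
    ∃ C ⊆ s, IsIndependentOn G x C ∧
      ∀ g : G, (∀ j ∈ C, g • x j = x j) → ∀ j ∈ s, g • x j = x j := by
  classical
  induction s using Finset.strongInduction with
  | H s ih =>
    by_cases hs : IsIndependentOn G x s
    · exact ⟨s, subset_rfl, hs, fun g hg => hg⟩
    · simp only [IsIndependentOn] at hs
      push Not at hs
      obtain ⟨i, hi, hfix⟩ := hs
      obtain ⟨C, hC, hCi, hCs⟩ := ih (s.erase i) (Finset.erase_ssubset hi)
      refine ⟨C, hC.trans (Finset.erase_subset _ _), hCi, fun g hg j hj => ?_⟩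
      have h1 := hCs g hg
      by_cases hji : j = i
      · subst hji
        exact hfix g fun l hl hlj => h1 l (Finset.mem_erase.mpr ⟨hlj, hl⟩)
      · exact h1 j (Finset.mem_erase.mpr ⟨hji, hj⟩)

theorem relationalComplexity_le_of_isIndependentOn (h : ℕ)
    (H : ∀ (k : ℕ) (x : Fin k → Ω) (C : Finset (Fin k)), IsIndependentOn G x C → C.card ≤ h) :
    relationalComplexity G Ω ≤ ((h + 1 : ℕ) : ℕ∞) := by
  classical
  refine relationalComplexity_le (h + 1) (by omega) fun k hk X Y hXY => ?_
  obtain ⟨C, -, hC, hCs⟩ := exists_isIndependentOn_subset G X Finset.univ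
  have hcard := H k X C hC
  obtain ⟨g, hg⟩ := hXY.exists_smul_eq hk C (by omega)
  refine ⟨g, fun j => ?_⟩
  obtain ⟨g', hg'⟩ := hXY.exists_smul_eq hk (insert j C)
    ((Finset.card_insert_le _ _).trans (by omega))
  -- Both `g` and `g'` carry `X` to `Y` on `C`, so their quotient fixes `X` on `C` and hence at `j`.
  -- The extra index `j` is the source of the `+ 1`.
  have hfix : ∀ i ∈ C, (g⁻¹ * g') • X i = X i := fun i hi => by
    rw [mul_smul, hg' i (Finset.mem_insert_of_mem hi), ← hg i hi, inv_smul_smul]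
  have h2 := hCs _ hfix j (Finset.mem_univ j)
  rw [mul_smul, inv_smul_eq_iff] at h2
  rw [← h2]
  exact hg' j (Finset.mem_insert_self _ _)

end GeneralBounds

/-! ### Cyclic groups: separating subgroups by primes -/

section Cyclic

variable {A ι : Type*} [CommGroup A] [Finite A] [IsCyclic A]

/-- In a cyclic group `x ^ m = 1` has at most `m` solutions, and for `m = orderOf b` the powers of
`b` already exhaust them. -/
theorem mem_zpowers_of_orderOf_dvd {a b : A} (h : orderOf a ∣ orderOf b) :
    a ∈ Subgroup.zpowers b := by
  classical
  have := Fintype.ofFinite A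
  have hsub : (Subgroup.zpowers b : Set A).toFinset ⊆
      Finset.univ.filter fun x : A => x ^ orderOf b = 1 := by
    intro x hx
    rw [Set.mem_toFinset] at hx
    obtain ⟨m, rfl⟩ := Subgroup.mem_zpowers_iff.mp hx
    simp only [Finset.mem_filter, Finset.mem_univ, true_and]
    rw [← zpow_natCast, zpow_comm, zpow_natCast, pow_orderOf_eq_one, one_zpow]
  have heq := Finset.eq_of_subset_of_card_le hsub (by
    refine (IsCyclic.card_pow_eq_one_le (orderOf_pos b)).trans ?_
    rw [Set.toFinset_card]
    exact (Fintype.card_zpowers (x := b)).ge)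
  have ha : a ∈ Finset.univ.filter fun x : A => x ^ orderOf b = 1 := by
    simp [orderOf_dvd_iff_pow_eq_one.mp h]
  rw [← heq, Set.mem_toFinset] at ha
  exact ha

/-- Take a prime `p` dividing the order of `a` modulo `H`, and raise `a` to the prime-to-`p` part of
the group order: this leaves an element of `p`-power order, and it cannot have entered `H`. -/
theorem exists_prime_pow_notMem (H : Subgroup A) {a : A} (ha : a ∉ H) :
    ∃ p k : ℕ, p.Prime ∧ p ∣ Nat.card A ∧ ∃ b ∈ Subgroup.zpowers a, b ∉ H ∧
      orderOf b = p ^ k := by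
  set o := orderOf (QuotientGroup.mk a : A ⧸ H) with ho
  have ho1 : o ≠ 1 := by
    rw [ho, Ne, orderOf_eq_one_iff, QuotientGroup.eq_one_iff]
    exact ha
  obtain ⟨p, hp, hpo⟩ := Nat.exists_prime_and_dvd ho1
  have hodvd : o ∣ Nat.card A := (orderOf_dvd_natCard _).trans (Subgroup.card_quotient_dvd_card H)
  have hN : Nat.card A ≠ 0 := Nat.card_pos.ne'
  obtain ⟨k, m, hm, hkm⟩ := Nat.exists_eq_pow_mul_and_not_dvd hN p hp.ne_one
  have hb : (a ^ m) ^ p ^ k = 1 := by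
    rw [← pow_mul, mul_comm, ← hkm, pow_card_eq_one']
  obtain ⟨k', -, hk'⟩ := (Nat.dvd_prime_pow hp).mp (orderOf_dvd_of_pow_eq_one hb)
  refine ⟨p, k', hp, hpo.trans hodvd, a ^ m, Subgroup.npow_mem_zpowers a m, fun hmem => hm ?_, hk'⟩
  rw [← QuotientGroup.eq_one_iff, QuotientGroup.mk_pow] at hmem
  exact hpo.trans (orderOf_dvd_of_pow_eq_one hmem)

/-- Each index receives a prime at which `a i` escapes `H i`. Two indices cannot share a prime: the
`p`-subgroups of a cyclic group form a chain, so the smaller of the two `p`-elements would be a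
power of the larger and hence lie in the subgroup it avoids. -/
theorem card_le_cardDistinctFactors (R : Finset ι) (H : ι → Subgroup A) (a : ι → A)
    (h1 : ∀ i ∈ R, a i ∉ H i) (h2 : ∀ i ∈ R, ∀ j ∈ R, j ≠ i → a i ∈ H j) :
    R.card ≤ ArithmeticFunction.cardDistinctFactors (Nat.card A) := by
  classical
  have hex : ∀ i : ι, ∃ p k : ℕ, i ∈ R → p.Prime ∧ p ∣ Nat.card A ∧
      ∃ b ∈ Subgroup.zpowers (a i), b ∉ H i ∧ orderOf b = p ^ k := fun i => by
    by_cases hi : i ∈ R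
    · obtain ⟨p, k, h⟩ := exists_prime_pow_notMem (H i) (h1 i hi)
      exact ⟨p, k, fun _ => h⟩
    · exact ⟨0, 0, fun h => absurd h hi⟩
  choose p k hpk using hex
  have hω : ArithmeticFunction.cardDistinctFactors (Nat.card A) =
      (Nat.card A).primeFactors.card := by
    rw [ArithmeticFunction.cardDistinctFactors_apply, Nat.primeFactors, List.card_toFinset]
  rw [hω]
  refine Finset.card_le_card_of_injOn p (fun i hi => ?_) fun i hi j hj hij => ?_
  · have := hpk i hi
    exact Nat.mem_primeFactors.mpr ⟨this.1, this.2.1, Nat.card_pos.ne'⟩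
  · by_contra hne
    have key : ∀ i ∈ R, ∀ j ∈ R, i ≠ j → p i = p j → k i ≤ k j → False := by
      intro i hi j hj hne hp hk
      obtain ⟨-, -, b, hb, hbH, hob⟩ := hpk i hi
      obtain ⟨-, -, c, hc, -, hoc⟩ := hpk j hj
      have hbc : b ∈ Subgroup.zpowers c := by
        apply mem_zpowers_of_orderOf_dvd
        rw [hob, hoc, hp]
        exact pow_dvd_pow _ hk
      have hcH : c ∈ H i := (Subgroup.zpowers_le.mpr (h2 j hj i hi hne)) hc
      exact hbH ((Subgroup.zpowers_le.mpr hcH) hbc)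
    rcases le_total (k i) (k j) with hk | hk
    · exact key i hi j hj hne hij hk
    · exact key j hj i hi (Ne.symm hne) hij.symm hk

end Cyclic

theorem IsIndependentOn.card_le_add {G Ω ι A : Type*} [Group G] [MulAction G Ω] [Group A]
    [Finite A] [IsCyclic A] (φ : G →* A) (x : ι → Ω) (h : ℕ)
    (H : ∀ C : Finset ι, IsIndependentOn φ.ker x C → C.card ≤ h) (C : Finset ι)
    (hC : IsIndependentOn G x C) :
    C.card ≤ h + ArithmeticFunction.cardDistinctFactors (Nat.card φ.range) := by
  classical
  let _ : CommGroup φ.range := IsCyclic.commGroup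
  obtain ⟨D, hDC, hD, hDfix⟩ := exists_isIndependentOn_subset φ.ker x C
  have hDcard := H D hD
  have hg : ∀ i : ι, ∃ g : G, i ∈ C → (∀ j ∈ C, j ≠ i → g • x j = x j) ∧ g • x i ≠ x i := fun i => by
    by_cases hi : i ∈ C
    · obtain ⟨g, hg⟩ := hC i hi
      exact ⟨g, fun _ => hg⟩
    · exact ⟨1, fun h => absurd h hi⟩
  choose g hg using hg
  -- `S i` is the pointwise stabilizer in `G` of the points indexed by `D` and `i`. The images of
  -- these groups in the cyclic quotient, with the images of the witnesses `g i`, form the separated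
  -- family that the prime count needs.
  let S : ι → Subgroup G := fun i =>
    { carrier := {f | ∀ j ∈ insert i D, f • x j = x j}
      one_mem' := fun j _ => one_smul _ _
      mul_mem' := fun {a b} ha hb j hj => by rw [mul_smul, hb j hj, ha j hj]
      inv_mem' := fun {a} ha j hj => by rw [inv_smul_eq_iff, ha j hj] }
  have hcard := card_le_cardDistinctFactors (C \ D) (fun i => (S i).map φ.rangeRestrict)
    (fun i => φ.rangeRestrict (g i)) (by
      rintro i hi ⟨f, hf, hfi⟩
      obtain ⟨hiC, hiD⟩ := Finset.mem_sdiff.mp hi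
      have hgi := hg i hiC
      -- If the image of `g i` came from some `f` in `S i`, the quotient would be a kernel element
      -- fixing `D`, hence all of `C`, and `g i` would fix `x i`.
      have hker : f⁻¹ * g i ∈ φ.ker := by
        rw [MonoidHom.mem_ker, map_mul, map_inv, inv_mul_eq_one]
        exact congrArg Subtype.val hfi
      have hfx : ∀ j ∈ C, (f⁻¹ * g i) • x j = x j := hDfix ⟨_, hker⟩ fun j hj => by
        change (f⁻¹ * g i) • x j = x j
        rw [mul_smul, hgi.1 j (hDC hj) (fun h => hiD (h ▸ hj)), inv_smul_eq_iff,
          hf j (Finset.mem_insert_of_mem hj)]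
      have h3 := hfx i hiC
      rw [mul_smul, inv_smul_eq_iff, hf i (Finset.mem_insert_self _ _)] at h3
      exact hgi.2 h3) (by
      intro i hi j hj hji
      obtain ⟨hiC, hiD⟩ := Finset.mem_sdiff.mp hi
      obtain ⟨hjC, hjD⟩ := Finset.mem_sdiff.mp hj
      refine ⟨g i, fun l hl => ?_, rfl⟩
      rcases Finset.mem_insert.mp hl with rfl | hl
      · exact (hg i hiC).1 _ hjC hji
      · exact (hg i hiC).1 _ (hDC hl) (fun h => hiD (h ▸ hl)))
  have := Finset.card_sdiff_add_card_eq_card hDC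
  omega

/-! ### Independent sets of points for the linear group -/

section LinearHeight

/-- The functions `t w` and the constant `1` are linearly independent in `J → K`: subtracting the
values of a relation at two points of `S w` where `t w` differs kills every term except that of `w`.
-/
theorem card_add_one_le_of_separating {K R J : Type*} [Field K] [Fintype R] [Fintype J] [Nonempty J]
    (t : R → J → K) (S : R → Finset J)
    (h1 : ∀ w w', w ≠ w' → ∀ i ∈ S w', ∀ j ∈ S w', t w i = t w j)
    (h2 : ∀ w, ∃ i ∈ S w, ∃ j ∈ S w, t w i ≠ t w j) :
    Fintype.card R + 1 ≤ Fintype.card J := by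
  classical
  have hli : LinearIndependent K (fun o : Option R => o.elim (fun _ => (1 : K)) t) := by
    rw [Fintype.linearIndependent_iff]
    intro g hg
    have hev : ∀ i, g none + ∑ w, g (some w) * t w i = 0 := fun i => by
      have := congrFun hg i
      simpa [Fintype.sum_option, Finset.sum_apply] using this
    have hsome : ∀ w, g (some w) = 0 := fun w => by
      obtain ⟨i, hi, j, hj, hij⟩ := h2 w
      have hd : ∑ w', g (some w') * (t w' i - t w' j) = 0 := by
        simp only [mul_sub, Finset.sum_sub_distrib]
        linear_combination hev i - hev j
      rw [Finset.sum_eq_single w (fun w' _ hw => by rw [h1 w' w hw i hi j hj, sub_self, mul_zero])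
        (fun h => absurd (Finset.mem_univ _) h)] at hd
      exact (mul_eq_zero.mp hd).resolve_right (sub_ne_zero.mpr hij)
    intro o
    cases o with
    | none => simpa [hsome] using hev (Classical.arbitrary J)
    | some w => exact hsome w
  simpa using hli.fintype_card_le_finrank

theorem card_add_two_le_of_separating {K R J : Type*} [Field K] [Fintype R] [Fintype J]
    (t : R → J → K) (S : R → Finset J)
    (h1 : ∀ w w', w ≠ w' → ∀ i ∈ S w', ∀ j ∈ S w', t w i = t w j)
    (h2 : ∀ w, ∃ i ∈ S w, ∃ j ∈ S w, t w i ≠ t w j) (w₀ : R) (h3 : 3 ≤ (S w₀).card) :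
    Fintype.card R + 2 ≤ Fintype.card J := by
  classical
  obtain ⟨a, b, c, ha, hb, hc, hab, hac, hbc⟩ := Finset.two_lt_card_iff.mp h3
  -- A set `S w₀` with three points leaves room for two functions in place of one: all other `t w`
  -- are constant on it, so `t w₀` may be replaced by the indicators of `a` and `b`, with `c` as
  -- reference point.
  let t' : R → J → K := fun w => if w = w₀ then Pi.single a 1 else t w
  have hli : LinearIndependent K (fun o : Option (Option R) =>
      o.elim (fun _ => (1 : K)) fun o' => o'.elim (Pi.single b 1) t') := by
    rw [Fintype.linearIndependent_iff]
    intro g hg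
    have hev : ∀ i, g none + (g (some none) * (Pi.single b 1 : J → K) i +
        ∑ w, g (some (some w)) * t' w i) = 0 := fun i => by
      have := congrFun hg i
      simpa [Fintype.sum_option, Finset.sum_apply] using this
    have hsplit : ∀ i, ∑ w, g (some (some w)) * t' w i =
        g (some (some w₀)) * (Pi.single a 1 : J → K) i +
          ∑ w ∈ Finset.univ.erase w₀, g (some (some w)) * t w i := fun i => by
      rw [← Finset.add_sum_erase _ _ (Finset.mem_univ w₀)]
      congr 1
      · simp [t']
      · exact Finset.sum_congr rfl fun w hw => by simp [t', Finset.ne_of_mem_erase hw]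
    have hconst : ∀ i ∈ S w₀, ∑ w ∈ Finset.univ.erase w₀, g (some (some w)) * t w i =
        ∑ w ∈ Finset.univ.erase w₀, g (some (some w)) * t w c := fun i hi =>
      Finset.sum_congr rfl fun w hw => by rw [h1 w w₀ (Finset.ne_of_mem_erase hw) i hi c hc]
    have ea := hev a
    have eb := hev b
    have ec := hev c
    rw [hsplit, hconst a ha] at ea
    rw [hsplit, hconst b hb] at eb
    rw [hsplit] at ec
    simp only [Pi.single_eq_same, Pi.single_eq_of_ne hab, Pi.single_eq_of_ne hab.symm,
      Pi.single_eq_of_ne hac.symm, Pi.single_eq_of_ne hbc.symm] at ea eb ec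
    have g0 : g (some (some w₀)) = 0 := by linear_combination ea - ec
    have g1 : g (some none) = 0 := by linear_combination eb - ec
    have hev' : ∀ i, g none + ∑ w ∈ Finset.univ.erase w₀, g (some (some w)) * t w i = 0 :=
      fun i => by
        have := hev i
        rw [hsplit, g0, g1] at this
        linear_combination this
    have hsome : ∀ w, g (some (some w)) = 0 := fun w => by
      by_cases hw0 : w = w₀
      · rw [hw0, g0]
      obtain ⟨i, hi, j, hj, hij⟩ := h2 w
      have hd : ∑ w' ∈ Finset.univ.erase w₀, g (some (some w')) * (t w' i - t w' j) = 0 := by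
        simp only [mul_sub, Finset.sum_sub_distrib]
        linear_combination hev' i - hev' j
      rw [Finset.sum_eq_single w (fun w' _ hw => by rw [h1 w' w hw i hi j hj, sub_self, mul_zero])
        (fun h => absurd (Finset.mem_erase.mpr ⟨hw0, Finset.mem_univ _⟩) h)] at hd
      exact (mul_eq_zero.mp hd).resolve_right (sub_ne_zero.mpr hij)
    rintro (_ | _ | w)
    · simpa [hsome] using hev' c
    · exact g1
    · exact hsome w
  simpa [Nat.succ_le_iff] using hli.fintype_card_le_finrank

variable {K V ι : Type*} [Field K] [AddCommGroup V] [Module K V]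

/-- Solving for `T e₂` through `v` puts it in the span of `e₁, e₂`, and through `w` in the span of
`e₂, e₃`; these planes meet in the line of `e₂`. -/
theorem eigenvector_of_two_triangles (T : V →ₗ[K] V) {e₁ e₂ e₃ v w : V}
    (hli : LinearIndependent K ![e₁, e₂, e₃]) {x y z u a b c d : K} (hy : y ≠ 0)
    (hz : z ≠ 0) (hv : v = x • e₁ + y • e₂) (hw : w = z • e₂ + u • e₃)
    (h1 : T e₁ = a • e₁) (h3 : T e₃ = b • e₃) (hTv : T v = c • v) (hTw : T w = d • w) :
    T e₂ = c • e₂ := by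
  have e1 : y • T e₂ = (c * x - x * a) • e₁ + (c * y) • e₂ := by
    have : T v = x • T e₁ + y • T e₂ := by rw [hv]; simp
    rw [h1, hTv, hv] at this
    linear_combination (norm := module) -this
  have e2 : z • T e₂ = (d * z) • e₂ + (d * u - u * b) • e₃ := by
    have : T w = z • T e₂ + u • T e₃ := by rw [hw]; simp
    rw [h3, hTw, hw] at this
    linear_combination (norm := module) -this
  have e3 : (z * (c * x - x * a)) • e₁ + (z * (c * y) - y * (d * z)) • e₂ +
      (-(y * (d * u - u * b))) • e₃ = 0 := by
    linear_combination (norm := module) y • e2 - z • e1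
  have := Fintype.linearIndependent_iff.mp hli
      ![z * (c * x - x * a), z * (c * y) - y * (d * z), -(y * (d * u - u * b))]
      (by simpa [Fin.sum_univ_three] using e3) 0
  have hzero : c * x - x * a = 0 := (mul_eq_zero.mp (by simpa using this)).resolve_left hz
  rw [hzero, zero_smul, zero_add, mul_comm, mul_smul] at e1
  exact (smul_right_injective V hy) e1

/-- With `J ⊆ C` a basis of the span and `S w` the support of `v w` in it, the eigenvalues of `T w`
on `J` are constant on the support of every other point but not on that of `w`. So `C \ J` has at
most `n - 1` elements, where `n` is the dimension, and `J` at most `n`. -/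
theorem card_le_of_independent_points [FiniteDimensional K V] (v : ι → V) (C : Finset ι) (h0 : ∀ i ∈ C, v i ≠ 0)
    (T : ι → V →ₗ[K] V) (hT : ∀ i ∈ C, ∀ j ∈ C, j ≠ i → ∃ c : K, T i (v j) = c • v j)
    (hT' : ∀ i ∈ C, ¬ ∃ c : K, T i (v i) = c • v i) :
    C.card ≤ 2 * Module.finrank K V - 1 ∧
      (3 ≤ Module.finrank K V → C.card ≤ 2 * Module.finrank K V - 2) := by
  classical
  rcases C.eq_empty_or_nonempty with rfl | ⟨i₀, hi₀⟩
  · simp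
  obtain ⟨b, hbC, -, hspan, hli⟩ := exists_linearIndepOn_extension (K := K) (v := v)
    (linearIndepOn_empty K v) (Set.empty_subset (C : Set ι))
  obtain ⟨J, rfl⟩ : ∃ J : Finset ι, (J : Set ι) = b :=
    ⟨(C.finite_toSet.subset hbC).toFinset, by simp⟩
  have hJC : J ⊆ C := by exact_mod_cast hbC
  have hli' : LinearIndependent K (fun j : J => v j) := hli
  have hex : ∀ w : (C \ J : Finset ι), ∃ a : J → K, ∑ j, a j • v j = v w := fun w => by
    have := hspan ⟨w.1, (Finset.mem_sdiff.mp w.2).1, rfl⟩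
    exact (Submodule.mem_span_image_finset_iff_exists_fun K).mp this
  choose a ha using hex
  have ht : ∀ i : C, ∃ t : ι → K, ∀ j ∈ C, j ≠ i → T i (v j) = t j • v j := fun i => by
    have : ∀ j, ∃ c : K, j ∈ C → j ≠ i → T i (v j) = c • v j := fun j => by
      by_cases hj : j ∈ C ∧ j ≠ i
      · obtain ⟨c, hc⟩ := hT i i.2 j hj.1 hj.2
        exact ⟨c, fun _ _ => hc⟩
      · exact ⟨0, fun h h' => absurd ⟨h, h'⟩ hj⟩
    choose t ht using this
    exact ⟨t, ht⟩
  choose t ht using ht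
  have hRC : ∀ w : (C \ J : Finset ι), w.1 ∈ C := fun w => (Finset.mem_sdiff.mp w.2).1
  have hRJ : ∀ (w : (C \ J : Finset ι)) (j : J), j.1 ≠ w.1 := fun w j h =>
    (Finset.mem_sdiff.mp w.2).2 (h ▸ j.2)
  let t' : (C \ J : Finset ι) → J → K := fun w j => t ⟨w, hRC w⟩ j
  have hTe : ∀ (w : (C \ J : Finset ι)) (j : J), T w (v j) = t' w j • v j := fun w j =>
    ht ⟨w, hRC w⟩ j (hJC j.2) (hRJ w j)
  let S : (C \ J : Finset ι) → Finset J := fun w => Finset.univ.filter fun j => a w j ≠ 0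
  have hS : ∀ w j, j ∈ S w ↔ a w j ≠ 0 := fun w j => by simp [S]
  have h1 : ∀ w w', w ≠ w' → ∀ i ∈ S w', ∀ j ∈ S w', t' w i = t' w j := by
    intro w w' hne
    obtain ⟨c, hc⟩ := hT w (hRC w) w' (hRC w') (fun h => hne (Subtype.ext h.symm))
    have key : ∀ i ∈ S w', t' w i = c := by
      intro i hi
      rw [← ha w', map_sum, Finset.smul_sum] at hc
      have hz : ∑ j, (a w' j * t' w j - c * a w' j) • v j = 0 := by
        simp only [sub_smul, Finset.sum_sub_distrib, mul_smul]
        rw [← hc, sub_eq_zero]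
        exact Finset.sum_congr rfl fun j _ => by rw [map_smul, hTe]
      have := Fintype.linearIndependent_iff.mp hli' _ hz i
      have h2 : a w' i * (t' w i - c) = 0 := by linear_combination this
      exact sub_eq_zero.mp ((mul_eq_zero.mp h2).resolve_left ((hS _ _).mp hi))
    intro i hi j hj
    rw [key i hi, key j hj]
  have h2 : ∀ w, ∃ i ∈ S w, ∃ j ∈ S w, t' w i ≠ t' w j := by
    intro w
    by_contra hcon
    push Not at hcon
    obtain ⟨i, hi⟩ : ∃ i, a w i ≠ 0 := by
      by_contra hall
      push Not at hall
      exact h0 w (hRC w) (by rw [← ha w]; simp [hall])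
    refine hT' w (hRC w) ⟨t' w i, ?_⟩
    rw [← ha w, map_sum, Finset.smul_sum]
    refine Finset.sum_congr rfl fun j _ => ?_
    rw [map_smul, hTe]
    by_cases hj : a w j = 0
    · simp [hj]
    · rw [hcon i ((hS _ _).mpr hi) j ((hS _ _).mpr hj), smul_comm]
  have hJn : J.card ≤ Module.finrank K V := by
    simpa using hli'.fintype_card_le_finrank
  have hJne : Nonempty J := by
    by_contra hemp
    rw [nonempty_subtype, not_exists] at hemp
    have hi₀J : i₀ ∈ C \ J := Finset.mem_sdiff.mpr ⟨hi₀, hemp i₀⟩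
    refine h0 i₀ hi₀ ?_
    rw [← ha ⟨i₀, hi₀J⟩]
    exact Finset.sum_eq_zero fun j _ => absurd j.2 (hemp j)
  have hRJcard := card_add_one_le_of_separating t' S h1 h2
  simp only [Fintype.card_coe] at hRJcard
  have hsum := Finset.card_sdiff_add_card_eq_card hJC
  refine ⟨by omega, fun hn => ?_⟩
  by_contra hlt
  have hJeq : J.card = Module.finrank K V := by omega
  have hReq : (C \ J).card + 1 = Module.finrank K V := by omega
  -- In the extremal case every support is a pair, since a larger one would improve the bound on `C
  -- \ J` by one.
  have hS2 : ∀ w, (S w).card = 2 := by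
    intro w
    obtain ⟨i, hi, j, hj, hij⟩ := h2 w
    have hge : 2 ≤ (S w).card := Finset.one_lt_card.mpr ⟨i, hi, j, hj, fun h => hij (h ▸ rfl)⟩
    by_contra hne
    have := card_add_two_le_of_separating t' S h1 h2 w (by omega)
    simp only [Fintype.card_coe] at this
    omega
  -- Disjoint pairs would occupy `2(n - 1)` basis vectors, more than `n` when `n ≥ 3`. At a shared
  -- basis vector `j` the two-triangle lemma then makes `v j` an eigenvector of its own witness `T
  -- j`.
  obtain ⟨w, w', hww, hdis⟩ : ∃ w w', w ≠ w' ∧ ¬ Disjoint (S w) (S w') := by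
    by_contra hall
    push Not at hall
    have hb := Finset.card_biUnion (s := Finset.univ) (t := S) fun x _ y _ hxy => hall x y hxy
    have hle := Finset.card_le_univ (Finset.univ.biUnion S)
    rw [hb] at hle
    simp only [hS2, Finset.sum_const, Finset.card_univ, Fintype.card_coe, smul_eq_mul] at hle
    omega
  obtain ⟨j, hjw, hjw'⟩ := Finset.not_disjoint_iff.mp hdis
  obtain ⟨i, hSi⟩ : ∃ i, S w = {j, i} ∧ i ≠ j := by
    obtain ⟨x, y, hxy, hSxy⟩ := Finset.card_eq_two.mp (hS2 w)
    rw [hSxy, Finset.mem_insert, Finset.mem_singleton] at hjw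
    rcases hjw with rfl | rfl
    · exact ⟨y, hSxy, hxy.symm⟩
    · exact ⟨x, by rw [hSxy, Finset.pair_comm], hxy⟩
  obtain ⟨k, hSk⟩ : ∃ k, S w' = {j, k} ∧ k ≠ j := by
    obtain ⟨x, y, hxy, hSxy⟩ := Finset.card_eq_two.mp (hS2 w')
    rw [hSxy, Finset.mem_insert, Finset.mem_singleton] at hjw'
    rcases hjw' with rfl | rfl
    · exact ⟨y, hSxy, hxy.symm⟩
    · exact ⟨x, by rw [hSxy, Finset.pair_comm], hxy⟩
  have hik : i ≠ k := by
    rintro rfl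
    obtain ⟨x, hx, y, hy, hxy⟩ := h2 w
    rw [hSi.1, ← hSk.1] at hx hy
    exact hxy (h1 w w' hww x hx y hy)
  have hsupp : ∀ u x, S u = {j, x} → x ≠ j → v u = a u j • v j + a u x • v x := by
    intro u x hSu hx
    rw [← ha u, ← Finset.sum_subset (Finset.subset_univ (S u)) fun y _ hy => by
      rw [hS, not_not] at hy; rw [hy, zero_smul], hSu, Finset.sum_pair hx.symm]
  have hne : ∀ y : J, y ≠ j → ∃ c : K, T j (v y) = c • v y := fun y hy =>
    hT j (hJC j.2) y (hJC y.2) (fun h => hy (Subtype.ext h))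
  obtain ⟨α, hα⟩ := hne i hSi.2
  obtain ⟨β, hβ⟩ := hne k hSk.2
  obtain ⟨γ, hγ⟩ := hT j (hJC j.2) w (hRC w) (hRJ w j).symm
  obtain ⟨δ, hδ⟩ := hT j (hJC j.2) w' (hRC w') (hRJ w' j).symm
  have hli3 : LinearIndependent K ![v i, v j, v k] := by
    have hinj : Function.Injective ![i, j, k] := by
      intro x y
      fin_cases x <;> fin_cases y <;> simp [hSi.2, hSk.2, hik, hSi.2.symm, hSk.2.symm, hik.symm]
    have := hli'.comp _ hinj
    convert this using 1
    ext x
    fin_cases x <;> rfl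
  have hnz : ∀ u x, x ∈ S u → a u x ≠ 0 := fun u x => (hS u x).mp
  exact hT' j (hJC j.2) ⟨γ, eigenvector_of_two_triangles (T j) hli3
    (hnz w j (by simp [hSi.1])) (hnz w' j (by simp [hSk.1]))
    (by rw [hsupp w i hSi.1 hSi.2, add_comm]) (hsupp w' k hSk.1 hSk.2) hα hβ hγ hδ⟩

end LinearHeight

/-! ### Semilinear maps -/

section SemilinearMaps

variable {K V : Type*} [Field K] [AddCommGroup V] [Module K V]

theorem gammaL_map_add (f : GammaL K V) (u v : V) : f.1 (u + v) = f.1 u + f.1 v := f.2.1 u v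

theorem gammaL_map_zero (f : GammaL K V) : f.1 0 = 0 := by simpa using gammaL_map_add f 0 0

theorem gammaL_map_sum {ι : Type*} (f : GammaL K V) (s : Finset ι) (v : ι → V) :
    f.1 (∑ i ∈ s, v i) = ∑ i ∈ s, f.1 (v i) :=
  map_sum (⟨⟨f.1, gammaL_map_zero f⟩, gammaL_map_add f⟩ : V →+ V) v s

theorem gammaL_ringEquiv_unique [Nontrivial V] (f : GammaL K V) {σ τ : K ≃+* K}
    (hσ : ∀ (c : K) (v : V), f.1 (c • v) = σ c • f.1 v)
    (hτ : ∀ (c : K) (v : V), f.1 (c • v) = τ c • f.1 v) : σ = τ := by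
  obtain ⟨v, hv⟩ := exists_ne (0 : V)
  ext c
  exact smul_left_injective K (GammaL.map_ne_zero f hv) ((hσ c v).symm.trans (hτ c v))

variable (K V) in
/-- The field automorphism associated with a bijective semilinear map. -/
noncomputable def gammaAut [Nontrivial V] : GammaL K V →* (K ≃+* K) where
  toFun f := f.2.2.choose
  map_one' := gammaL_ringEquiv_unique (1 : GammaL K V) (1 : GammaL K V).2.2.choose_spec
    fun _ _ => rfl
  map_mul' f g := gammaL_ringEquiv_unique (f * g) (f * g).2.2.choose_spec fun c v => by
    change f.1 (g.1 (c • v)) = f.2.2.choose (g.2.2.choose c) • f.1 (g.1 v)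
    rw [g.2.2.choose_spec, f.2.2.choose_spec]

theorem gammaL_map_smul [Nontrivial V] (f : GammaL K V) (c : K) (v : V) :
    f.1 (c • v) = gammaAut K V f c • f.1 v :=
  f.2.2.choose_spec c v

theorem gammaAut_eq [Nontrivial V] (f : GammaL K V) {σ : K ≃+* K}
    (hσ : ∀ (c : K) (v : V), f.1 (c • v) = σ c • f.1 v) : gammaAut K V f = σ :=
  gammaL_ringEquiv_unique f (gammaL_map_smul f) hσ

theorem gammaAut_linear [Nontrivial V] (T : V ≃ₗ[K] V) :
    gammaAut K V (linearToGammaL K V T) = 1 :=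
  gammaAut_eq _ fun c v => map_smul T c v

theorem exists_linear_of_gammaAut_eq_one [Nontrivial V] (f : GammaL K V)
    (hf : gammaAut K V f = 1) : ∃ T : V ≃ₗ[K] V, linearToGammaL K V T = f :=
  ⟨{ f.1 with
      map_add' := gammaL_map_add f
      map_smul' := fun c v => by
        change f.1 (c • v) = c • f.1 v
        rw [gammaL_map_smul f, hf]
        rfl }, rfl⟩

theorem mk_eq_mk_of_smul {f g : GammaL K V} {c : K} (hc : c ≠ 0)
    (h : ∀ v, f.1 v = c • g.1 v) : (f : PGammaL K V) = g := by
  rw [eq_comm, QuotientGroup.eq]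
  obtain ⟨-, σ, hσ⟩ := g.2
  refine ⟨Units.mk0 (σ.symm c) (by simpa using hc), fun v => ?_⟩
  change g.1.symm (f.1 v) = σ.symm c • v
  apply g.1.injective
  rw [Equiv.apply_symm_apply, h, hσ, RingEquiv.apply_symm_apply]

theorem gammaAut_of_mem_scalarGL [Nontrivial V] {f : GammaL K V} (hf : f ∈ scalarGL K V) :
    gammaAut K V f = 1 := by
  obtain ⟨a, ha⟩ := hf
  refine gammaAut_eq f fun c v => ?_
  rw [ha, ha, Units.smul_def, Units.smul_def, smul_comm]
  rfl

variable (K V) in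
/-- The field automorphism associated with an element of `PΓL(V)`. -/
noncomputable def pGammaAut [Nontrivial V] : PGammaL K V →* (K ≃+* K) :=
  QuotientGroup.lift (scalarGL K V) (gammaAut K V) fun _ => gammaAut_of_mem_scalarGL

theorem pGammaAut_mk [Nontrivial V] (f : GammaL K V) :
    pGammaAut K V (f : PGammaL K V) = gammaAut K V f := rfl

theorem linear_mem_PGL (T : V ≃ₗ[K] V) : (linearToGammaL K V T : PGammaL K V) ∈ PGL K V :=
  ⟨_, ⟨T, rfl⟩, rfl⟩

theorem ker_pGammaAut [Nontrivial V] : (pGammaAut K V).ker = PGL K V := by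
  ext g
  induction g using QuotientGroup.induction_on with
  | H f =>
    rw [MonoidHom.mem_ker, pGammaAut_mk]
    constructor
    · intro h
      obtain ⟨T, rfl⟩ := exists_linear_of_gammaAut_eq_one f h
      exact linear_mem_PGL T
    · rintro ⟨_, ⟨T, rfl⟩, h⟩
      rw [← pGammaAut_mk, ← h]
      exact gammaAut_linear T

theorem mk_smul_mk_eq_iff (f : GammaL K V) {x y : V} (hx : x ≠ 0) (hy : y ≠ 0) :
    (f : PGammaL K V) • Projectivization.mk K x hx = Projectivization.mk K y hy ↔
      ∃ c : K, f.1 x = c • y := by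
  rw [pGammaL_smul, gammaL_smul_mk, Projectivization.mk_eq_mk_iff']
  exact exists_congr fun c => eq_comm

theorem card_le_relationalComplexity_of_vectors {ι : Type*} [Fintype ι]
    (G : Subgroup (PGammaL K V)) (x y : ι → V) (hx : ∀ i, x i ≠ 0) (hy : ∀ i, y i ≠ 0)
    (h : ∀ i₀, ∃ f : GammaL K V, (f : PGammaL K V) ∈ G ∧ ∀ i, i ≠ i₀ → ∃ c : K, f.1 (x i) = c • y i)
    (hne : ∀ f : GammaL K V, (f : PGammaL K V) ∈ G → ¬ ∀ i, ∃ c : K, f.1 (x i) = c • y i) :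
    (Fintype.card ι : ℕ∞) ≤ relationalComplexity G (ℙ K V) := by
  refine card_le_relationalComplexity (fun i => Projectivization.mk K (x i) (hx i))
    (fun i => Projectivization.mk K (y i) (hy i)) (fun i₀ => ?_) ?_
  · obtain ⟨f, hf, hfi⟩ := h i₀
    exact ⟨⟨f, hf⟩, fun i hi => (mk_smul_mk_eq_iff f (hx i) (hy i)).mpr (hfi i hi)⟩
  · rintro ⟨⟨g, hg⟩, hgi⟩
    obtain ⟨f, rfl⟩ := QuotientGroup.mk_surjective g
    exact hne f hg fun i => (mk_smul_mk_eq_iff f (hx i) (hy i)).mp (hgi i)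

theorem exists_dilation [FiniteDimensional K V] (φ : Module.Dual K V) (u : V) (h : 1 + φ u ≠ 0) :
    ∃ T : V ≃ₗ[K] V, (∀ x, T x = x + φ x • u) ∧ LinearMap.det (T : V →ₗ[K] V) = 1 + φ u := by
  refine ⟨LinearEquiv.dilatransvection (isUnit_iff_ne_zero.mpr h), fun x => ?_, ?_⟩
  · rw [LinearEquiv.dilatransvection.apply]
  · rw [LinearEquiv.dilatransvection.coe_toLinearMap, LinearMap.transvection.det]

end SemilinearMaps

/-! ### Determinants of semilinear maps -/

section Determinants

variable {K : Type*} [Field K] {n : ℕ}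

theorem exists_dilation_coord (c : K) (i : Fin n) (u : Fin n → K) (h : 1 + c * u i ≠ 0) :
    ∃ T : (Fin n → K) ≃ₗ[K] (Fin n → K), (∀ x, T x = x + (c * x i) • u) ∧
      LinearMap.det (T : (Fin n → K) →ₗ[K] (Fin n → K)) = 1 + c * u i :=
  exists_dilation (c • LinearMap.proj i : (Fin n → K) →ₗ[K] K) u h

theorem exists_dilation_coord_sub (c : K) (i j : Fin n) (u : Fin n → K)
    (h : 1 + c * (u i - u j) ≠ 0) :
    ∃ T : (Fin n → K) ≃ₗ[K] (Fin n → K), (∀ x, T x = x + (c * (x i - x j)) • u) ∧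
      LinearMap.det (T : (Fin n → K) →ₗ[K] (Fin n → K)) = 1 + c * (u i - u j) :=
  exists_dilation (K := K) (V := Fin n → K)
    { toFun := fun x => c * (x i - x j)
      map_add' := fun x y => by simp only [Pi.add_apply]; ring
      map_smul' := fun a x => by
        simp only [Pi.smul_apply, smul_eq_mul, RingHom.id_apply]; ring } u h

theorem det_linearEquiv_ne_zero (T : (Fin n → K) ≃ₗ[K] (Fin n → K)) :
    LinearMap.det (T : (Fin n → K) →ₗ[K] (Fin n → K)) ≠ 0 := by
  rw [← LinearEquiv.coe_det]
  exact Units.ne_zero _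

theorem linear_mem_PSL (T : (Fin n → K) ≃ₗ[K] (Fin n → K)) {c : K} (hc : c ≠ 0)
    (hT : LinearMap.det (T : (Fin n → K) →ₗ[K] (Fin n → K)) = c ^ n) :
    (linearToGammaL K (Fin n → K) T : PGammaL K (Fin n → K)) ∈ PSL K (Fin n → K) := by
  have hc' := inv_ne_zero hc
  -- A scalar `c` has determinant `c ^ n`, so only the determinant modulo `n`-th powers matters
  -- projectively.
  let S : (Fin n → K) ≃ₗ[K] (Fin n → K) := T.trans (LinearEquiv.smulOfNeZero K _ c⁻¹ hc')
  have hS : LinearEquiv.det S = 1 := by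
    ext
    have : (S : (Fin n → K) →ₗ[K] (Fin n → K)) = c⁻¹ • (T : (Fin n → K) →ₗ[K] (Fin n → K)) := rfl
    rw [LinearEquiv.coe_det, this, LinearMap.det_smul, hT, Module.finrank_fin_fun, inv_pow,
      inv_mul_cancel₀ (pow_ne_zero _ hc), Units.val_one]
  refine ⟨linearToGammaL K _ S, ⟨S, hS, rfl⟩, ?_⟩
  exact mk_eq_mk_of_smul hc' fun v => rfl

theorem linear_mem_of_det {G : Subgroup (PGammaL K (Fin n → K))} (hG : PSL K (Fin n → K) ≤ G)
    {S T : (Fin n → K) ≃ₗ[K] (Fin n → K)}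
    (hT : (linearToGammaL K (Fin n → K) T : PGammaL K (Fin n → K)) ∈ G) {c : K} (hc : c ≠ 0)
    (h : LinearMap.det (S : (Fin n → K) →ₗ[K] (Fin n → K)) =
      LinearMap.det (T : (Fin n → K) →ₗ[K] (Fin n → K)) * c ^ n) :
    (linearToGammaL K (Fin n → K) S : PGammaL K (Fin n → K)) ∈ G := by
  have h1 : (linearToGammaL K (Fin n → K) (S * T⁻¹) : PGammaL K (Fin n → K)) ∈ G := by
    refine hG (linear_mem_PSL _ hc ?_)
    have h2 : LinearEquiv.det (S * T⁻¹) = LinearEquiv.det S * (LinearEquiv.det T)⁻¹ := by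
      rw [map_mul, map_inv]
    rw [← LinearEquiv.coe_det, h2, Units.val_mul, Units.val_inv_eq_inv_val, LinearEquiv.coe_det,
      LinearEquiv.coe_det, h]
    field_simp [det_linearEquiv_ne_zero T]
  have h2 := G.mul_mem h1 hT
  rwa [← QuotientGroup.mk_mul, ← map_mul, inv_mul_cancel_right] at h2

theorem PGL_le_of_det [NeZero n] {G : Subgroup (PGammaL K (Fin n → K))}
    (hG : PSL K (Fin n → K) ≤ G)
    (h : ∀ d : K, d ≠ 0 → ∃ T : (Fin n → K) ≃ₗ[K] (Fin n → K),
      (linearToGammaL K (Fin n → K) T : PGammaL K (Fin n → K)) ∈ G ∧ ∃ c : K, c ≠ 0 ∧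
        d = LinearMap.det (T : (Fin n → K) →ₗ[K] (Fin n → K)) * c ^ n) :
    PGL K (Fin n → K) ≤ G := by
  rintro _ ⟨_, ⟨S, rfl⟩, rfl⟩
  obtain ⟨T, hT, c, hc, hd⟩ := h _ (det_linearEquiv_ne_zero S)
  exact linear_mem_of_det hG hT hc hd

/-- The matrix whose columns are the images of the standard basis vectors. -/
def gammaMatrix (f : GammaL K (Fin n → K)) : Matrix (Fin n) (Fin n) K :=
  Matrix.of fun i j => f.1 (Pi.single j 1) i

/-- The determinant of a semilinear map with respect to the standard basis. -/
def gammaDet (f : GammaL K (Fin n → K)) : K := (gammaMatrix f).det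

theorem gammaDet_fieldAut (σ : K ≃+* K) : gammaDet (fieldAutToGammaL K n σ) = 1 := by
  rw [gammaDet, show gammaMatrix (fieldAutToGammaL K n σ) = 1 from ?_, Matrix.det_one]
  ext i j
  change σ ((Pi.single j 1 : Fin n → K) i) = _
  by_cases h : i = j
  · subst h
    simp
  · simp [h]

theorem gammaMatrix_linear (T : (Fin n → K) ≃ₗ[K] (Fin n → K)) :
    gammaMatrix (linearToGammaL K _ T) = LinearMap.toMatrix' (T : (Fin n → K) →ₗ[K] (Fin n → K)) := by
  ext i j
  rw [LinearMap.toMatrix'_apply]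
  rfl

theorem gammaDet_linear (T : (Fin n → K) ≃ₗ[K] (Fin n → K)) :
    gammaDet (linearToGammaL K _ T) = LinearMap.det (T : (Fin n → K) →ₗ[K] (Fin n → K)) := by
  rw [gammaDet, gammaMatrix_linear, LinearMap.det_toMatrix']

variable [NeZero n]

theorem gammaL_apply_eq_mulVec (f : GammaL K (Fin n → K)) (x : Fin n → K) :
    f.1 x = (gammaMatrix f).mulVec fun i => gammaAut K _ f (x i) := by
  have hx : x = ∑ j, x j • (Pi.single j 1 : Fin n → K) := by
    simpa using (pi_eq_sum_univ' x)
  conv_lhs => rw [hx, gammaL_map_sum f]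
  ext i
  simp only [gammaL_map_smul f, Finset.sum_apply, Pi.smul_apply, smul_eq_mul, Matrix.mulVec, dotProduct,
    gammaMatrix, Matrix.of_apply]
  exact Finset.sum_congr rfl fun j _ => mul_comm _ _

theorem gammaMatrix_mul (f g : GammaL K (Fin n → K)) :
    gammaMatrix (f * g) = gammaMatrix f * (gammaMatrix g).map (gammaAut K _ f) := by
  ext i j
  change f.1 (g.1 (Pi.single j 1)) i = _
  rw [gammaL_apply_eq_mulVec f]
  rfl

/-- The determinant is only a crossed homomorphism on semilinear maps; this twist drives the later
commutator and conjugation computations. -/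
theorem gammaDet_mul (f g : GammaL K (Fin n → K)) :
    gammaDet (f * g) = gammaDet f * gammaAut K _ f (gammaDet g) := by
  rw [gammaDet, gammaMatrix_mul, Matrix.det_mul]
  congr 1
  exact (RingHom.map_det (gammaAut K _ f : K →+* K) (gammaMatrix g)).symm

theorem gammaAut_fieldAut (σ : K ≃+* K) : gammaAut K _ (fieldAutToGammaL K n σ) = σ :=
  gammaAut_eq _ fun c v => funext fun i => map_mul σ c (v i)

theorem gammaDet_ne_zero (f : GammaL K (Fin n → K)) : gammaDet f ≠ 0 := by
  intro h
  have h1 := gammaDet_mul f f⁻¹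
  have h2 : gammaDet (1 : GammaL K (Fin n → K)) = 1 := by
    rw [← map_one (fieldAutToGammaL K n), gammaDet_fieldAut]
  rw [mul_inv_cancel, h, zero_mul, h2] at h1
  exact one_ne_zero h1

theorem exists_linear_mul_fieldAut (f : GammaL K (Fin n → K)) :
    ∃ T : (Fin n → K) ≃ₗ[K] (Fin n → K),
      f = linearToGammaL K _ T * fieldAutToGammaL K n (gammaAut K _ f) := by
  obtain ⟨T, hT⟩ := exists_linear_of_gammaAut_eq_one
    (f * (fieldAutToGammaL K n (gammaAut K _ f))⁻¹) (by
      rw [map_mul, map_inv, gammaAut_fieldAut, mul_inv_cancel])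
  exact ⟨T, by rw [hT, inv_mul_cancel_right]⟩

variable (K n) in
/-- The semilinear maps whose determinant is an `n`-th power. -/
def powDetGammaL : Subgroup (GammaL K (Fin n → K)) where
  carrier := {f | ∃ c : K, gammaDet f = c ^ n}
  one_mem' := ⟨1, by rw [← map_one (fieldAutToGammaL K n), gammaDet_fieldAut, one_pow]⟩
  mul_mem' := by
    rintro f g ⟨a, ha⟩ ⟨b, hb⟩
    exact ⟨a * gammaAut K _ f b, by rw [gammaDet_mul, ha, hb, map_pow, mul_pow]⟩
  inv_mem' := by
    rintro f ⟨a, ha⟩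
    refine ⟨gammaAut K _ f⁻¹ a⁻¹, ?_⟩
    have h := gammaDet_mul f⁻¹ f
    rw [inv_mul_cancel, ← map_one (fieldAutToGammaL K n), gammaDet_fieldAut, ha] at h
    rw [← map_pow, inv_pow, map_inv₀]
    exact eq_inv_of_mul_eq_one_left h.symm

/-- Elements of `SL` and coordinatewise field automorphisms have determinant `1`, and dividing by
scalars introduces exactly the `n`-th powers. -/
theorem mem_PSigmaL_iff (f : GammaL K (Fin n → K)) :
    (f : PGammaL K (Fin n → K)) ∈ PSigmaL K n ↔ ∃ c : K, gammaDet f = c ^ n := by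
  constructor
  · rintro ⟨g, hg, hgf⟩
    have hle : SLGamma K (Fin n → K) ⊔ (fieldAutToGammaL K n).range ≤ powDetGammaL K n := by
      refine sup_le ?_ ?_
      · rintro _ ⟨T, hT, rfl⟩
        refine ⟨1, ?_⟩
        rw [gammaDet_linear, ← LinearEquiv.coe_det, MonoidHom.mem_ker.mp hT, one_pow, Units.val_one]
      · rintro _ ⟨σ, rfl⟩
        exact ⟨1, by rw [gammaDet_fieldAut, one_pow]⟩
    have hs : g⁻¹ * f ∈ powDetGammaL K n := by
      obtain ⟨a, ha⟩ := QuotientGroup.eq.mp hgf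
      refine ⟨a, ?_⟩
      rw [gammaDet, show gammaMatrix (g⁻¹ * f) = (a : K) • (1 : Matrix (Fin n) (Fin n) K) from ?_,
        Matrix.det_smul, Matrix.det_one, mul_one, Fintype.card_fin]
      ext i j
      change (g⁻¹ * f : GammaL K (Fin n → K)).1 (Pi.single j 1) i = _
      rw [ha]
      simp [Units.smul_def, Matrix.one_apply, Pi.single_apply]
    have h := (powDetGammaL K n).mul_mem (hle hg) hs
    rwa [mul_inv_cancel_left] at h
  · rintro ⟨c, hc⟩
    have hc0 : c ≠ 0 := by
      rintro rfl
      rw [zero_pow (NeZero.ne n)] at hc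
      exact gammaDet_ne_zero f hc
    obtain ⟨T, hT⟩ := exists_linear_mul_fieldAut f
    rw [hT, gammaDet_mul, gammaDet_fieldAut, map_one, mul_one, gammaDet_linear] at hc
    rw [hT, QuotientGroup.mk_mul]
    refine mul_mem ?_ ?_
    · exact (Subgroup.map_mono le_sup_left) (linear_mem_PSL T hc0 hc)
    · exact (Subgroup.map_mono le_sup_right) ⟨_, ⟨_, rfl⟩, rfl⟩

end Determinants

/-! ### Automorphisms of finite fields -/

section FiniteFields

variable {K : Type*} [Field K] [Finite K]

instance finite_ringAut : Finite (K ≃+* K) :=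
  Finite.of_injective (fun σ : K ≃+* K => (σ : K → K)) DFunLike.coe_injective

variable (K) in
theorem exists_injective_ringAut_to_galois :
    ∃ (p : ℕ) (_ : Fact p.Prime) (_ : Algebra (ZMod p) K),
      ∃ f : (K ≃+* K) →* Gal(K/ZMod p), Function.Injective f ∧ ∀ σ x, f σ x = σ x := by
  have := Fintype.ofFinite K
  obtain ⟨p, hp⟩ := CharP.exists K
  have hp' : Fact p.Prime := ⟨CharP.char_is_prime K p⟩
  let _ := ZMod.algebra K p
  refine ⟨p, hp', inferInstance,
    { toFun := fun σ => AlgEquiv.ofRingEquiv (f := σ) fun x => ?_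
      map_one' := ?_
      map_mul' := ?_ }, ?_, ?_⟩
  · exact RingHom.congr_fun (Subsingleton.elim ((σ : K →+* K).comp (algebraMap (ZMod p) K))
      (algebraMap (ZMod p) K)) x
  · ext; rfl
  · intro σ τ; ext; rfl
  · intro σ τ h
    ext x
    exact AlgEquiv.congr_fun h x
  · intro σ x; rfl

instance isCyclic_ringAut : IsCyclic (K ≃+* K) := by
  obtain ⟨p, _, _, f, hf, -⟩ := exists_injective_ringAut_to_galois K
  exact isCyclic_of_injective f hf

/-- Automorphisms are powers of Frobenius. The exponent makes their effect on power classes of the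
multiplicative group explicit. -/
theorem exists_ringAut_eq_pow (σ : K ≃+* K) : ∃ m : ℕ, ∀ x, σ x = x ^ m := by
  obtain ⟨p, _, _, f, -, hf⟩ := exists_injective_ringAut_to_galois K
  obtain ⟨i, hi⟩ := (FiniteField.bijective_frobeniusAlgEquivOfAlgebraic_pow (ZMod p) K).2 (f σ)
  refine ⟨Fintype.card (ZMod p) ^ (i : ℕ), fun x => ?_⟩
  rw [← hf, ← hi]
  simp only
  rw [AlgEquiv.coe_pow, FiniteField.coe_frobeniusAlgEquivOfAlgebraic_iterate]

end FiniteFields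

/-! ### Upper bounds -/

section UpperBounds

variable {K : Type*} [Field K] {n : ℕ} [NeZero n]

theorem IsIndependentOn.exists_linear {V ι : Type*} [AddCommGroup V] [Module K V] [Nontrivial V]
    {G : Subgroup (PGammaL K V)} {x : ι → ℙ K V} {C : Finset ι}
    (h : IsIndependentOn ((pGammaAut K V).comp G.subtype).ker x C) :
    ∃ T : ι → V →ₗ[K] V, (∀ i ∈ C, ∀ j ∈ C, j ≠ i → ∃ c : K, T i (x j).rep = c • (x j).rep) ∧
      ∀ i ∈ C, ¬ ∃ c : K, T i (x i).rep = c • (x i).rep := by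
  have hT : ∀ i, ∃ T : V →ₗ[K] V, i ∈ C →
      (∀ j ∈ C, j ≠ i → ∃ c : K, T (x j).rep = c • (x j).rep) ∧
      ¬ ∃ c : K, T (x i).rep = c • (x i).rep := fun i => by
    by_cases hi : i ∈ C
    · obtain ⟨⟨⟨g, hgG⟩, hg⟩, h1, h2⟩ := h i hi
      obtain ⟨f, rfl⟩ := QuotientGroup.mk_surjective g
      obtain ⟨T, rfl⟩ := exists_linear_of_gammaAut_eq_one f hg
      have key : ∀ j, (linearToGammaL K V T : PGammaL K V) • x j = x j ↔
          ∃ c : K, T (x j).rep = c • (x j).rep := fun j => by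
        have := mk_smul_mk_eq_iff (linearToGammaL K V T) (x j).rep_nonzero (x j).rep_nonzero
        rwa [Projectivization.mk_rep] at this
      exact ⟨T, fun _ => ⟨fun j hj hji => (key j).mp (h1 j hj hji), fun hc => h2 ((key i).mpr hc)⟩⟩
    · exact ⟨0, fun h => absurd h hi⟩
  choose T hT using hT
  exact ⟨T, fun i hi => (hT i hi).1, fun i hi => (hT i hi).2⟩

variable [Finite K]

theorem relationalComplexity_le_of_linear_height (G : Subgroup (PGammaL K (Fin n → K))) (h : ℕ)
    (H : ∀ (k : ℕ) (x : Fin k → ℙ K (Fin n → K)) (C : Finset (Fin k)),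
      IsIndependentOn ((pGammaAut K (Fin n → K)).comp G.subtype).ker x C → C.card ≤ h) :
    relationalComplexity G (ℙ K (Fin n → K)) ≤
      ((h + 1 + ArithmeticFunction.cardDistinctFactors ((PGL K (Fin n → K)).relIndex G) : ℕ) :
        ℕ∞) := by
  have hcard : Nat.card ((pGammaAut K (Fin n → K)).comp G.subtype).range =
      (PGL K (Fin n → K)).relIndex G := by
    rw [← ker_pGammaAut, Subgroup.relIndex_ker, MonoidHom.range_comp, Subgroup.range_subtype]
  rw [← hcard, add_right_comm]
  exact relationalComplexity_le_of_isIndependentOn _ fun k x C hC =>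
    hC.card_le_add ((pGammaAut K (Fin n → K)).comp G.subtype) x h (H k x) C

theorem relationalComplexity_le_two_mul (G : Subgroup (PGammaL K (Fin n → K))) :
    relationalComplexity G (ℙ K (Fin n → K)) ≤
      ((2 * n + ArithmeticFunction.cardDistinctFactors ((PGL K (Fin n → K)).relIndex G) : ℕ) :
        ℕ∞) := by
  have hn := NeZero.ne n
  have := relationalComplexity_le_of_linear_height G (2 * n - 1) fun k x C hC => by
    obtain ⟨T, h1, h2⟩ := hC.exists_linear
    have := (card_le_of_independent_points _ C (fun i _ => (x i).rep_nonzero) T h1 h2).1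
    rwa [Module.finrank_fin_fun] at this
  rwa [Nat.sub_add_cancel (by omega)] at this

theorem relationalComplexity_le_two_mul_sub_one (hn : 3 ≤ n)
    (G : Subgroup (PGammaL K (Fin n → K))) :
    relationalComplexity G (ℙ K (Fin n → K)) ≤
      ((2 * n - 1 + ArithmeticFunction.cardDistinctFactors ((PGL K (Fin n → K)).relIndex G) : ℕ) :
        ℕ∞) := by
  have := relationalComplexity_le_of_linear_height G (2 * n - 2) fun k x C hC => by
    obtain ⟨T, h1, h2⟩ := hC.exists_linear
    have := (card_le_of_independent_points _ C (fun i _ => (x i).rep_nonzero) T h1 h2).2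
    rw [Module.finrank_fin_fun] at this
    exact this hn
  rwa [show 2 * n - 2 + 1 = 2 * n - 1 by omega] at this

end UpperBounds

/-! ### Frames and configurations with two parameters -/

section Frames

variable {K : Type*} [Field K] {n : ℕ}

/-- The sum of the standard basis vectors indexed by `U`. -/
def unitSum (K : Type*) [Field K] {n : ℕ} (U : Finset (Fin n)) : Fin n → K :=
  fun i => if i ∈ U then 1 else 0

theorem unitSum_eq_sum (U : Finset (Fin n)) :
    unitSum K U = ∑ i ∈ U, (Pi.single i 1 : Fin n → K) := by
  ext j
  simp [unitSum, Finset.sum_apply, Pi.single_apply]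

theorem gammaL_frame_scalar (f : GammaL K (Fin n → K)) (U : Finset (Fin n)) (c : Fin n → K) (d : K)
    (h : ∀ i ∈ U, f.1 (Pi.single i 1) = c i • (Pi.single i 1 : Fin n → K))
    (hs : f.1 (unitSum K U) = d • unitSum K U) : ∀ i ∈ U, c i = d := by
  intro i hi
  rw [unitSum_eq_sum, gammaL_map_sum, Finset.sum_congr rfl h, Finset.smul_sum] at hs
  have := congrFun hs i
  simpa [Finset.sum_apply, Pi.single_apply, hi] using this

theorem exists_generator_fixed_only_by_one [Finite K] :
    ∃ ζ : K, ∀ ρ : K ≃+* K, ρ ζ = ζ → ρ = 1 := by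
  obtain ⟨g, hg⟩ := IsCyclic.exists_generator (α := Kˣ)
  refine ⟨g, fun ρ hρ => ?_⟩
  ext x
  by_cases hx : x = 0
  · simp [hx]
  obtain ⟨m, hm⟩ := Subgroup.mem_zpowers_iff.mp (hg (Units.mk0 x hx))
  have hx' : x = (g : K) ^ m := by
    rw [← Units.val_zpow_eq_zpow_val, hm, Units.val_mk0]
  rw [hx', map_zpow₀, hρ]
  rfl

/-- The points `e i` (`i ∈ U`), `s`, `e i₁ + a e i₂` and `e i₃ + b s`, where `s` is the sum of
the `e i`. -/
def twoParamConfig (U : Finset (Fin n)) (i₁ i₂ i₃ : Fin n) (a b : K) : U ⊕ Fin 3 → Fin n → K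
  | Sum.inl i => Pi.single i.1 1
  | Sum.inr 0 => unitSum K U
  | Sum.inr 1 => Pi.single i₁ 1 + a • Pi.single i₂ 1
  | Sum.inr 2 => Pi.single i₃ 1 + b • unitSum K U

variable {U : Finset (Fin n)} {i₁ i₂ i₃ : Fin n}

theorem twoParamConfig_ne_zero (h1 : i₁ ∈ U) (h12 : i₁ ≠ i₂) (h13 : i₁ ≠ i₃) {a b : K}
    (hb : b ≠ 0) (o : U ⊕ Fin 3) : twoParamConfig U i₁ i₂ i₃ a b o ≠ 0 := by
  intro h
  rcases o with i | k
  · have := congrFun h i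
    simp [twoParamConfig] at this
  · have := congrFun h i₁
    fin_cases k <;> simp [twoParamConfig, unitSum, h1, h12, h13, hb] at this

theorem twoParamConfig_apply_eq_zero (h1 : i₁ ∈ U) (h2 : i₂ ∈ U) (h3 : i₃ ∈ U) {a b : K}
    (o : U ⊕ Fin 3) {i : Fin n} (hi : i ∉ U) : twoParamConfig U i₁ i₂ i₃ a b o i = 0 := by
  have hne : ∀ j ∈ U, i ≠ j := fun j hj h => hi (h ▸ hj)
  rcases o with j | k
  · simp [twoParamConfig, hne j j.2]
  · fin_cases k <;> simp [twoParamConfig, unitSum, hi, hne _ h1, hne _ h2, hne _ h3]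

theorem twoParamConfig_map (σ : K ≃+* K) (a b : K) (o : U ⊕ Fin 3) :
    (fun i => σ (twoParamConfig U i₁ i₂ i₃ a b o i)) =
      twoParamConfig U i₁ i₂ i₃ (σ a) (σ b) o := by
  ext i
  rcases o with j | k
  · simp [twoParamConfig, Pi.single_apply, apply_ite σ]
  · fin_cases k <;> simp [twoParamConfig, unitSum, Pi.single_apply, apply_ite σ]

/-- A difference of two coordinates in `U` vanishes on the sum `s`. A dilation along such a
functional therefore fixes `s`, and it disturbs only the basis vectors of those two coordinates: one
is rescaled and the other is the omitted point. -/
theorem exists_change_first (h1 : i₁ ∈ U) (h2 : i₂ ∈ U) (h12 : i₁ ≠ i₂)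
    (h13 : i₁ ≠ i₃) (h23 : i₂ ≠ i₃) {a a' b : K} (ha : a ≠ 0) (ha1 : a ≠ 1) (ha' : a' ≠ 0)
    (ha1' : a' ≠ 1) (o₀ : U ⊕ Fin 3) (ho : (∃ j : U, o₀ = Sum.inl j ∧ j.1 ≠ i₃) ∨ o₀ = Sum.inr 1) :
    ∃ T : (Fin n → K) ≃ₗ[K] (Fin n → K), ∀ o, o ≠ o₀ →
      ∃ c : K, T (twoParamConfig U i₁ i₂ i₃ a b o) = c • twoParamConfig U i₁ i₂ i₃ a' b o := by
  have hd : a - 1 ≠ 0 := sub_ne_zero.mpr ha1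
  have hd' : a' - 1 ≠ 0 := sub_ne_zero.mpr ha1'
  have hd2 : 1 - a ≠ 0 := sub_ne_zero.mpr ha1.symm
  have hd2' : 1 - a' ≠ 0 := sub_ne_zero.mpr ha1'.symm
  rcases ho with ⟨⟨j, hj⟩, rfl, hj3 : j ≠ i₃⟩ | rfl
  · by_cases hj1 : j = i₁
    · subst hj1
      -- A dilation with factor `r` sends the parameter `a` to `1 + r (a - 1)`, which has to be
      -- `a'`.
      obtain ⟨T, hT, -⟩ := exists_dilation_coord_sub ((a' - 1) / (a - 1) - 1) i₂ j (Pi.single i₂ 1)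
        (by simpa [h12] using ⟨hd', hd⟩)
      refine ⟨T, ?_⟩
      rintro (⟨i, hi⟩ | k) hne
      · have hij : i ≠ j := fun h => hne (by subst h; rfl)
        by_cases hi2 : i = i₂
        · subst hi2
          refine ⟨(a' - 1) / (a - 1), ?_⟩
          rw [hT]
          ext l
          simp [twoParamConfig, hij.symm]
          ring
        · refine ⟨1, ?_⟩
          rw [hT]
          simp [twoParamConfig, hij.symm, Ne.symm hi2]
      · fin_cases k
        · exact ⟨1, by rw [hT]; simp [twoParamConfig, unitSum, h1, h2]⟩
        · refine ⟨1, ?_⟩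
          rw [hT]
          ext l
          simp [twoParamConfig, h12, h12.symm]
          field_simp
          ring
        · exact ⟨1, by rw [hT]; simp [twoParamConfig, unitSum, h1, h2, h13, h23]⟩
    by_cases hj2 : j = i₂
    · subst hj2
      obtain ⟨T, hT, -⟩ := exists_dilation_coord_sub (a * (1 - a') / (a' * (1 - a)) - 1) i₁ j
        (Pi.single i₁ 1)
        (by simpa [h12, h12.symm] using ⟨⟨ha, hd2'⟩, ha', hd2⟩)
      refine ⟨T, ?_⟩
      rintro (⟨i, hi⟩ | k) hne
      · have hij : i ≠ j := fun h => hne (by subst h; rfl)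
        by_cases hi1 : i = i₁
        · subst hi1
          refine ⟨a * (1 - a') / (a' * (1 - a)), ?_⟩
          rw [hT]
          ext l
          simp [twoParamConfig, hij.symm]
          ring
        · refine ⟨1, ?_⟩
          rw [hT]
          simp [twoParamConfig, hij.symm, Ne.symm hi1]
      · fin_cases k
        · exact ⟨1, by rw [hT]; simp [twoParamConfig, unitSum, h1, h2]⟩
        · refine ⟨a / a', ?_⟩
          rw [hT]
          ext l
          simp [twoParamConfig, h12, h12.symm]
          field_simp
          ring
        · exact ⟨1, by rw [hT]; simp [twoParamConfig, unitSum, h1, h2, h13, h23]⟩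
    · obtain ⟨T, hT, -⟩ := exists_dilation_coord_sub (a / a' - 1) i₁ j (Pi.single i₁ 1)
        (by simpa [hj1] using ⟨ha, ha'⟩)
      refine ⟨T, ?_⟩
      rintro (⟨i, hi⟩ | k) hne
      · have hij : i ≠ j := fun h => hne (by subst h; rfl)
        by_cases hi1 : i = i₁
        · subst hi1
          refine ⟨a / a', ?_⟩
          rw [hT]
          ext l
          simp [twoParamConfig, hij.symm]
          ring
        · refine ⟨1, ?_⟩
          rw [hT]
          simp [twoParamConfig, hij.symm, Ne.symm hi1]
      · fin_cases k
        · exact ⟨1, by rw [hT]; simp [twoParamConfig, unitSum, h1, hj]⟩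
        · refine ⟨a / a', ?_⟩
          rw [hT]
          ext l
          simp [twoParamConfig, h12, hj1, hj2]
          field_simp
          ring
        · exact ⟨1, by rw [hT]; simp [twoParamConfig, unitSum, h1, hj, h13, hj3]⟩
  · refine ⟨LinearEquiv.refl K _, ?_⟩
    rintro (i | k) hne
    · exact ⟨1, by simp [twoParamConfig]⟩
    · fin_cases k
      · exact ⟨1, by simp [twoParamConfig]⟩
      · exact absurd rfl hne
      · exact ⟨1, by simp [twoParamConfig]⟩

/-- The line through `e i₃`, `s` and `e i₃ + b s` carries the second parameter. Without `e i₃`,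
rescaling `s` along the coordinate `i₃` moves `b`; without `s`, rescaling `e i₃` does. -/
theorem exists_change_second (h3 : i₃ ∈ U) (h13 : i₁ ≠ i₃) (h23 : i₂ ≠ i₃) {a b b' : K} (hb : b ≠ 0) (hb1 : 1 + b ≠ 0) (hb' : b' ≠ 0)
    (hb1' : 1 + b' ≠ 0) (o₀ : U ⊕ Fin 3)
    (ho : (∃ j : U, o₀ = Sum.inl j ∧ j.1 = i₃) ∨ o₀ = Sum.inr 0 ∨ o₀ = Sum.inr 2) :
    ∃ T : (Fin n → K) ≃ₗ[K] (Fin n → K), ∀ o, o ≠ o₀ →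
      ∃ c : K, T (twoParamConfig U i₁ i₂ i₃ a b o) = c • twoParamConfig U i₁ i₂ i₃ a b' o := by
  rcases ho with ⟨⟨j, hj⟩, rfl, rfl : j = i₃⟩ | rfl | rfl
  · obtain ⟨T, hT, -⟩ := exists_dilation_coord ((1 + b') / (1 + b) - 1) j (unitSum K U)
      (by simpa [unitSum, h3] using ⟨hb1', hb1⟩)
    refine ⟨T, ?_⟩
    rintro (⟨i, hi⟩ | k) hne
    · have hij : i ≠ j := fun h => hne (by subst h; rfl)
      exact ⟨1, by rw [hT]; simp [twoParamConfig, hij.symm]⟩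
    · fin_cases k
      · refine ⟨(1 + b') / (1 + b), ?_⟩
        rw [hT]
        ext l
        simp [twoParamConfig, unitSum, h3]
        split_ifs <;> ring
      · exact ⟨1, by rw [hT]; simp [twoParamConfig, h13.symm, h23.symm]⟩
      · refine ⟨1, ?_⟩
        rw [hT]
        ext l
        simp [twoParamConfig, unitSum, h3]
        field_simp
        split_ifs <;> ring
  · obtain ⟨T, hT, -⟩ := exists_dilation_coord (b * (1 + b') / (b' * (1 + b)) - 1) i₃
      (Pi.single i₃ 1) (by simpa using ⟨⟨hb, hb1'⟩, hb', hb1⟩)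
    refine ⟨T, ?_⟩
    rintro (⟨i, hi⟩ | k) hne
    · by_cases hi3 : i = i₃
      · subst hi3
        refine ⟨b * (1 + b') / (b' * (1 + b)), ?_⟩
        rw [hT]
        ext l
        simp [twoParamConfig]
        ring
      · exact ⟨1, by rw [hT]; simp [twoParamConfig, Ne.symm hi3]⟩
    · fin_cases k
      · exact absurd rfl hne
      · exact ⟨1, by rw [hT]; simp [twoParamConfig, h13.symm, h23.symm]⟩
      · refine ⟨b / b', ?_⟩
        rw [hT]
        ext l
        simp [twoParamConfig, unitSum, h3]
        field_simp
        split_ifs <;> ring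
  · refine ⟨LinearEquiv.refl K _, ?_⟩
    rintro (i | k) hne
    · exact ⟨1, by simp [twoParamConfig]⟩
    · fin_cases k
      · exact ⟨1, by simp [twoParamConfig]⟩
      · exact ⟨1, by simp [twoParamConfig]⟩
      · exact absurd rfl hne

/-- On the span of the frame the map is a scalar times a field automorphism. The first extra point
shows that this automorphism fixes `ζ`, and the second then cannot change its parameter. -/
theorem twoParamConfig_rigid [NeZero n] (h1 : i₁ ∈ U) (h2 : i₂ ∈ U) (h3 : i₃ ∈ U) (h12 : i₁ ≠ i₂)
    (h13 : i₁ ≠ i₃) {ζ b : K} (f : GammaL K (Fin n → K)) (hf : ∀ o, ∃ c : K,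
      f.1 (twoParamConfig U i₁ i₂ i₃ ζ ζ o) = c • twoParamConfig U i₁ i₂ i₃ ζ b o) : b = ζ := by
  choose c hc using hf
  have he : ∀ i ∈ U, f.1 (Pi.single i 1) = c (Sum.inr 0) • (Pi.single i 1 : Fin n → K) := by
    have hscal := gammaL_frame_scalar f U
      (fun i => if h : i ∈ U then c (Sum.inl ⟨i, h⟩) else 0) (c (Sum.inr 0))
      (fun i hi => by rw [dif_pos hi]; exact hc (Sum.inl ⟨i, hi⟩)) (hc (Sum.inr 0))
    intro i hi
    have h := hscal i hi
    simp only [hi, dite_true] at h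
    rw [← h]
    exact hc (Sum.inl ⟨i, hi⟩)
  have hs : f.1 (unitSum K U) = c (Sum.inr 0) • unitSum K U := hc (Sum.inr 0)
  have hd : c (Sum.inr 0) ≠ 0 := by
    intro h0
    have := GammaL.map_ne_zero f (v := (Pi.single i₁ 1 : Fin n → K)) (by simp)
    rw [he i₁ h1, h0, zero_smul] at this
    exact this rfl
  have hv := hc (Sum.inr 1)
  have hw := hc (Sum.inr 2)
  simp only [twoParamConfig] at hv hw
  rw [gammaL_map_add, gammaL_map_smul, he i₁ h1, he i₂ h2] at hv
  rw [gammaL_map_add, gammaL_map_smul, he i₃ h3, hs] at hw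
  have v1 : c (Sum.inr 0) = c (Sum.inr 1) := by simpa [h12] using congrFun hv i₁
  have v2 : gammaAut K _ f ζ * c (Sum.inr 0) = c (Sum.inr 1) * ζ := by
    simpa [h12.symm] using congrFun hv i₂
  have hρ : gammaAut K _ f ζ = ζ := by
    apply mul_right_cancel₀ hd
    rw [v2, v1, mul_comm]
  have w1 : gammaAut K _ f ζ * c (Sum.inr 0) = c (Sum.inr 2) * b := by
    simpa [h13, unitSum, h1] using congrFun hw i₁
  have w3 : c (Sum.inr 0) + gammaAut K _ f ζ * c (Sum.inr 0) = c (Sum.inr 2) * (1 + b) := by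
    simpa [unitSum, h3] using congrFun hw i₃
  rw [hρ] at w1 w3
  have h02 : c (Sum.inr 0) = c (Sum.inr 2) := by linear_combination w3 - w1
  rw [← h02] at w1
  apply mul_left_cancel₀ hd
  rw [← w1, mul_comm]

theorem card_add_three_le_relationalComplexity [Finite K] [NeZero n]
    {G : Subgroup (PGammaL K (Fin n → K))} (hGe : ¬ G ≤ PGL K (Fin n → K)) (h1 : i₁ ∈ U)
    (h2 : i₂ ∈ U) (h3 : i₃ ∈ U) (h12 : i₁ ≠ i₂) (h13 : i₁ ≠ i₃) (h23 : i₂ ≠ i₃)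
    (hG : ∀ T : (Fin n → K) ≃ₗ[K] (Fin n → K), ∃ S : (Fin n → K) ≃ₗ[K] (Fin n → K),
      (linearToGammaL K (Fin n → K) S : PGammaL K (Fin n → K)) ∈ G ∧
        ∀ x : Fin n → K, (∀ i, i ∉ U → x i = 0) → S x = T x) :
    ((U.card + 3 : ℕ) : ℕ∞) ≤ relationalComplexity G (ℙ K (Fin n → K)) := by
  -- An element of `G` outside `PGL`, stripped of its linear part by `hG`, acts on vectors supported
  -- in `U` as a nontrivial coordinatewise automorphism.
  obtain ⟨τ, hτ, f, hfG, hf⟩ : ∃ τ : K ≃+* K, τ ≠ 1 ∧ ∃ f : GammaL K (Fin n → K),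
      (f : PGammaL K (Fin n → K)) ∈ G ∧
        ∀ x : Fin n → K, (∀ i, i ∉ U → x i = 0) → f.1 x = fun i => τ (x i) := by
    obtain ⟨g, hg, hgP⟩ := SetLike.not_le_iff_exists.mp hGe
    obtain ⟨f, rfl⟩ := QuotientGroup.mk_surjective g
    rw [← ker_pGammaAut, MonoidHom.mem_ker] at hgP
    refine ⟨gammaAut K _ f, hgP, ?_⟩
    obtain ⟨T, hT⟩ := exists_linear_mul_fieldAut f
    obtain ⟨S, hS, hST⟩ := hG T
    refine ⟨(linearToGammaL K _ S)⁻¹ * f, G.mul_mem (G.inv_mem hS) hg, fun x hx => ?_⟩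
    set τ := gammaAut K _ f
    change S.symm (f.1 x) = _
    rw [hT, LinearEquiv.symm_apply_eq, hST _ fun i hi => by simp [hx i hi]]
    rfl
  obtain ⟨ζ, hζ⟩ := exists_generator_fixed_only_by_one (K := K)
  have hτζ : τ ζ ≠ ζ := fun h => hτ (hζ τ h)
  have hz0 : ζ ≠ 0 := by rintro rfl; simp at hτζ
  have hz1 : ζ ≠ 1 := by rintro rfl; simp at hτζ
  have hz2 : 1 + ζ ≠ 0 := by
    intro h
    have : ζ = -1 := by linear_combination h
    rw [this] at hτζ
    simp at hτζ
  have ht0 : τ ζ ≠ 0 := by simpa using hz0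
  have ht1 : τ ζ ≠ 1 := by simpa using hz1
  have ht2 : 1 + τ ζ ≠ 0 := by
    rw [← map_one τ, ← map_add]
    exact fun h => hz2 ((map_eq_zero τ).mp h)
  have key := card_le_relationalComplexity_of_vectors G
    (twoParamConfig U i₁ i₂ i₃ ζ ζ) (twoParamConfig U i₁ i₂ i₃ ζ (τ ζ))
    (twoParamConfig_ne_zero h1 h12 h13 hz0) (twoParamConfig_ne_zero h1 h12 h13 ht0)
    (fun o₀ => by
      by_cases ho : (∃ j : U, o₀ = Sum.inl j ∧ j.1 = i₃) ∨ o₀ = Sum.inr 0 ∨ o₀ = Sum.inr 2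
      · obtain ⟨T, hT⟩ := exists_change_second (a := ζ) h3 h13 h23 hz0 hz2 ht0 ht2 o₀ ho
        obtain ⟨S, hS, hST⟩ := hG T
        refine ⟨_, hS, fun o hne => ?_⟩
        obtain ⟨c, hc⟩ := hT o hne
        exact ⟨c, (hST _ fun i => twoParamConfig_apply_eq_zero h1 h2 h3 o).trans hc⟩
      · have ho' : (∃ j : U, o₀ = Sum.inl j ∧ j.1 ≠ i₃) ∨ o₀ = Sum.inr 1 := by
          push Not at ho
          rcases o₀ with j | k
          · exact Or.inl ⟨j, rfl, ho.1 j rfl⟩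
          · right
            fin_cases k
            · exact absurd rfl ho.2.1
            · rfl
            · exact absurd rfl ho.2.2
        -- Here `τ` first moves both parameters to `τ ζ`, and the linear map then restores the first
        -- one to `ζ`.
        obtain ⟨T, hT⟩ := exists_change_first (b := τ ζ) h1 h2 h12 h13 h23 ht0 ht1 hz0 hz1 o₀ ho'
        obtain ⟨S, hS, hST⟩ := hG T
        refine ⟨linearToGammaL K _ S * f, G.mul_mem hS hfG, fun o hne => ?_⟩
        obtain ⟨c, hc⟩ := hT o hne
        refine ⟨c, ?_⟩
        change S (f.1 _) = _
        rw [hf _ fun i => twoParamConfig_apply_eq_zero h1 h2 h3 o, twoParamConfig_map,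
          hST _ fun i => twoParamConfig_apply_eq_zero h1 h2 h3 o, hc])
    (fun g _ hg => hτζ (twoParamConfig_rigid h1 h2 h3 h12 h13 g hg))
  simpa using key

theorem add_three_le_relationalComplexity [Finite K] [NeZero n] (hn : 3 ≤ n)
    {G : Subgroup (PGammaL K (Fin n → K))} (hGe : ¬ G ≤ PGL K (Fin n → K))
    (hG : PGL K (Fin n → K) ≤ G) :
    ((n + 3 : ℕ) : ℕ∞) ≤ relationalComplexity G (ℙ K (Fin n → K)) := by
  have := card_add_three_le_relationalComplexity (U := Finset.univ) (i₁ := ⟨0, by omega⟩)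
    (i₂ := ⟨1, by omega⟩) (i₃ := ⟨2, by omega⟩) hGe (by simp) (by simp) (by simp) (by simp)
    (by simp) (by simp) fun T => ⟨T, hG (linear_mem_PGL T), fun _ _ => rfl⟩
  simpa using this

theorem add_two_le_relationalComplexity_of_four_le [Finite K] [NeZero n] (hn : 4 ≤ n)
    {G : Subgroup (PGammaL K (Fin n → K))} (hGe : ¬ G ≤ PGL K (Fin n → K))
    (hG : PSL K (Fin n → K) ≤ G) :
    ((n + 2 : ℕ) : ℕ∞) ≤ relationalComplexity G (ℙ K (Fin n → K)) := by
  have := card_add_three_le_relationalComplexity (U := Finset.univ.erase ⟨3, by omega⟩)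
    (i₁ := ⟨0, by omega⟩) (i₂ := ⟨1, by omega⟩) (i₃ := ⟨2, by omega⟩) hGe (by simp) (by simp)
    (by simp) (by simp) (by simp) (by simp) fun T => by
      have hd := det_linearEquiv_ne_zero T
      -- The coordinate left out of `U` is rescaled to make the determinant `1`; the configuration
      -- does not see it.
      obtain ⟨D, hD, hdet⟩ := exists_dilation_coord
        ((LinearMap.det (T : (Fin n → K) →ₗ[K] (Fin n → K)))⁻¹ - 1) (⟨3, by omega⟩ : Fin n)
        (Pi.single ⟨3, by omega⟩ 1) (by simpa using hd)
      refine ⟨D.trans T, hG (linear_mem_PSL _ one_ne_zero ?_), fun x hx => ?_⟩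
      · rw [LinearEquiv.coe_trans, LinearMap.det_comp, hdet]
        simp [hd]
      · rw [LinearEquiv.trans_apply, hD]
        simp [hx ⟨3, by omega⟩]
  rw [Finset.card_erase_of_mem (Finset.mem_univ _), Finset.card_fin] at this
  rwa [show n - 1 + 3 = n + 2 by omega] at this

end Frames

/-! ### A lower bound from minimal connected configurations -/

section ConnectedConfigurations

variable {K : Type*} [Field K] {n : ℕ} {i₁ i₂ : Fin n}

/-- The points `e i` and `d e i₁ + e i₂ + e j` for `j ≠ i₁, i₂`. -/
def bookConfig (i₁ i₂ : Fin n) (d : K) : Fin n ⊕ {j : Fin n // j ≠ i₁ ∧ j ≠ i₂} → Fin n → K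
  | Sum.inl i => Pi.single i 1
  | Sum.inr j => Pi.single i₁ d + Pi.single i₂ 1 + Pi.single j.1 1

theorem bookConfig_ne_zero (h12 : i₁ ≠ i₂) (d : K)
    (o : Fin n ⊕ {j : Fin n // j ≠ i₁ ∧ j ≠ i₂}) : bookConfig i₁ i₂ d o ≠ 0 := by
  intro h
  rcases o with i | ⟨j, hj1, hj2⟩
  · have := congrFun h i
    simp [bookConfig] at this
  · have := congrFun h i₂
    simp [bookConfig, h12.symm, hj2.symm] at this

/-- The whole configuration ties all coordinates together, but omitting any one point frees a
dilation of arbitrary determinant that fixes the rest. -/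
theorem exists_fixing_bookConfig (h12 : i₁ ≠ i₂) {l : K} (hl : l ≠ 0)
    (o₀ : Fin n ⊕ {j : Fin n // j ≠ i₁ ∧ j ≠ i₂}) :
    ∃ T : (Fin n → K) ≃ₗ[K] (Fin n → K),
      LinearMap.det (T : (Fin n → K) →ₗ[K] (Fin n → K)) = l ∧
        ∀ o, o ≠ o₀ → ∃ c : K, T (bookConfig i₁ i₂ 1 o) = c • bookConfig i₁ i₂ 1 o := by
  rcases o₀ with j | ⟨j, hj1, hj2⟩
  · by_cases hj1 : j = i₁
    · subst hj1
      obtain ⟨T, hT, hdet⟩ := exists_dilation_coord_sub (l - 1) i₂ j (Pi.single i₂ 1)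
        (by simpa [h12] using hl)
      refine ⟨T, by rw [hdet]; simp [h12], ?_⟩
      rintro (i | ⟨i, hi1, hi2⟩) hne
      · have hij : i ≠ j := fun h => hne (by rw [h])
        by_cases hi : i = i₂
        · subst hi
          refine ⟨l, ?_⟩
          rw [hT]
          ext k
          simp [bookConfig, hij.symm]
          ring
        · exact ⟨1, by rw [hT]; simp [bookConfig, hij.symm, Ne.symm hi]⟩
      · exact ⟨1, by rw [hT]; simp [bookConfig, h12, h12.symm, hi1.symm, hi2.symm]⟩
    by_cases hj2 : j = i₂
    · subst hj2
      obtain ⟨T, hT, hdet⟩ := exists_dilation_coord_sub (l - 1) i₁ j (Pi.single i₁ 1)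
        (by simpa [h12.symm] using hl)
      refine ⟨T, by rw [hdet]; simp [h12.symm], ?_⟩
      rintro (i | ⟨i, hi1, hi2⟩) hne
      · have hij : i ≠ j := fun h => hne (by rw [h])
        by_cases hi : i = i₁
        · subst hi
          refine ⟨l, ?_⟩
          rw [hT]
          ext k
          simp [bookConfig, hij.symm]
          ring
        · exact ⟨1, by rw [hT]; simp [bookConfig, hij.symm, Ne.symm hi]⟩
      · exact ⟨1, by rw [hT]; simp [bookConfig, h12, h12.symm, hi1.symm, hi2.symm]⟩
    · obtain ⟨T, hT, hdet⟩ := exists_dilation_coord (l - 1) j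
        (bookConfig i₁ i₂ 1 (Sum.inr ⟨j, hj1, hj2⟩)) (by simpa [bookConfig, hj1, hj2] using hl)
      refine ⟨T, by rw [hdet]; simp [bookConfig, hj1, hj2], ?_⟩
      rintro (i | ⟨i, hi1, hi2⟩) hne
      · have hij : i ≠ j := fun h => hne (by rw [h])
        exact ⟨1, by rw [hT]; simp [bookConfig, hij.symm]⟩
      · by_cases hij : i = j
        · subst hij
          refine ⟨l, ?_⟩
          rw [hT]
          ext k
          simp [bookConfig, hj1, hj2]
          ring
        · exact ⟨1, by rw [hT]; simp [bookConfig, hj1, hj2, Ne.symm hij]⟩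
  · obtain ⟨T, hT, hdet⟩ := exists_dilation_coord (l - 1) j (Pi.single j 1) (by simpa using hl)
    refine ⟨T, by rw [hdet]; simp, ?_⟩
    rintro (i | ⟨i, hi1, hi2⟩) hne
    · by_cases hij : i = j
      · subst hij
        refine ⟨l, ?_⟩
        rw [hT]
        ext k
        simp [bookConfig]
        ring
      · exact ⟨1, by rw [hT]; simp [bookConfig, Ne.symm hij]⟩
    · have hij : i ≠ j := fun h => hne (by subst h; rfl)
      exact ⟨1, by rw [hT]; simp [bookConfig, hj1, hj2, hij.symm]⟩

/-- The basis points make the matrix diagonal, and the remaining points force all diagonal entries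
to be equal except for one extra factor `d` at `i₁`. At least one index besides `i₁, i₂` is needed
for this, hence `3 ≤ n`. -/
theorem gammaDet_of_bookConfig [NeZero n] (h12 : i₁ ≠ i₂) (hn : 3 ≤ n) {d : K}
    (f : GammaL K (Fin n → K))
    (hf : ∀ o, ∃ c : K, f.1 (bookConfig i₁ i₂ 1 o) = c • bookConfig i₁ i₂ d o) :
    ∃ c : K, gammaDet f = d * c ^ n := by
  choose c hc using hf
  have he : ∀ i, f.1 (Pi.single i 1) = c (Sum.inl i) • (Pi.single i 1 : Fin n → K) :=
    fun i => hc (Sum.inl i)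
  have hb : ∀ j : {j : Fin n // j ≠ i₁ ∧ j ≠ i₂},
      c (Sum.inl i₁) = d * c (Sum.inl i₂) ∧ c (Sum.inl j.1) = c (Sum.inl i₂) := by
    rintro ⟨j, hj1, hj2⟩
    have h := hc (Sum.inr ⟨j, hj1, hj2⟩)
    simp only [bookConfig] at h
    rw [gammaL_map_add, gammaL_map_add, he, he, he] at h
    have h1 := congrFun h i₁
    have h2 := congrFun h i₂
    have h3 := congrFun h j
    simp [h12, h12.symm, hj1, hj1.symm, hj2, hj2.symm] at h1 h2 h3
    exact ⟨by rw [h1, h2, mul_comm], h3.trans h2.symm⟩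
  obtain ⟨j₀, hj₀⟩ : ∃ j : Fin n, j ≠ i₁ ∧ j ≠ i₂ := by
    by_contra hall
    push Not at hall
    have hsub : (Finset.univ : Finset (Fin n)) ⊆ {i₁, i₂} := fun j _ => by
      by_cases hj : j = i₁
      · simp [hj]
      · simp [hall j hj]
    have := (Finset.card_le_card hsub).trans (Finset.card_le_two)
    rw [Finset.card_fin] at this
    omega
  have hci : ∀ i, c (Sum.inl i) = c (Sum.inl i₂) * (if i = i₁ then d else 1) := by
    intro i
    by_cases h1 : i = i₁
    · rw [h1, (hb ⟨j₀, hj₀⟩).1, if_pos rfl, mul_comm]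
    · rw [if_neg h1, mul_one]
      by_cases h2 : i = i₂
      · rw [h2]
      · exact (hb ⟨i, h1, h2⟩).2
  refine ⟨c (Sum.inl i₂), ?_⟩
  have hM : gammaMatrix f = Matrix.diagonal fun i => c (Sum.inl i) := by
    ext i j
    rw [gammaMatrix, Matrix.of_apply, he, Matrix.diagonal_apply]
    by_cases hij : i = j
    · subst hij
      simp
    · simp [hij]
  rw [gammaDet, hM, Matrix.det_diagonal, Finset.prod_congr rfl fun i _ => hci i,
    Finset.prod_mul_distrib, Finset.prod_const, Finset.card_univ, Fintype.card_fin,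
    Finset.prod_ite_eq']
  simp [mul_comm]

theorem two_mul_sub_two_le_relationalComplexity [NeZero n] (hn : 3 ≤ n)
    {G : Subgroup (PGammaL K (Fin n → K))} (hG : PSL K (Fin n → K) ≤ G) (hG' : G ≤ PSigmaL K n)
    (hne : PSigmaL K n ≠ ⊤) :
    ((2 * n - 2 : ℕ) : ℕ∞) ≤ relationalComplexity G (ℙ K (Fin n → K)) := by
  obtain ⟨d, hd, hdn⟩ : ∃ d : K, d ≠ 0 ∧ ¬ ∃ c : K, d = c ^ n := by
    by_contra hall
    push Not at hall
    refine hne (Subgroup.eq_top_iff' _ |>.mpr fun g => ?_)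
    obtain ⟨f, rfl⟩ := QuotientGroup.mk_surjective g
    exact (mem_PSigmaL_iff f).mpr (hall _ (gammaDet_ne_zero f))
  let i₁ : Fin n := ⟨0, by omega⟩
  let i₂ : Fin n := ⟨1, by omega⟩
  have h12 : i₁ ≠ i₂ := by simp [i₁, i₂]
  -- `k` carries one configuration to the other with determinant `d`, not an `n`-th power. After an
  -- omission, a map of determinant `d⁻¹` fixing the other points corrects it into `PSL`.
  obtain ⟨k, hk, hkdet⟩ := exists_dilation_coord (d - 1) i₁ (Pi.single i₁ 1) (by simpa using hd)
  have hkX : ∀ o, k (bookConfig i₁ i₂ 1 o) =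
      (if o = Sum.inl i₁ then d else 1) • bookConfig i₁ i₂ d o := by
    intro o
    rw [hk]
    rcases o with i | ⟨j, hj1, hj2⟩
    · by_cases hi : i = i₁
      · subst hi
        ext l
        simp [bookConfig]
        ring
      · ext l
        simp [bookConfig, hi, Ne.symm hi]
    · ext l
      simp [bookConfig, h12, hj1.symm, Pi.single_apply]
      split_ifs <;> ring
  have key := card_le_relationalComplexity_of_vectors G (bookConfig i₁ i₂ (1 : K))
    (bookConfig i₁ i₂ d) (bookConfig_ne_zero h12 1) (bookConfig_ne_zero h12 d)
    (fun o₀ => by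
      obtain ⟨T, hTdet, hT⟩ := exists_fixing_bookConfig h12 (inv_ne_zero hd) o₀
      refine ⟨_, hG (linear_mem_PSL (T.trans k) one_ne_zero ?_), fun o ho => ?_⟩
      · rw [LinearEquiv.coe_trans, LinearMap.det_comp, hTdet, hkdet]
        simp [hd]
      · obtain ⟨c, hc⟩ := hT o ho
        refine ⟨c * (if o = Sum.inl i₁ then d else 1), ?_⟩
        change k (T _) = _
        rw [hc, map_smul, hkX, mul_smul])
    (fun f hfG hf => by
      obtain ⟨c, hc⟩ := gammaDet_of_bookConfig h12 hn f hf
      obtain ⟨b, hb⟩ := (mem_PSigmaL_iff f).mp (hG' hfG)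
      have hc0 : c ≠ 0 := by
        rintro rfl
        rw [zero_pow (NeZero.ne n), mul_zero] at hc
        exact gammaDet_ne_zero f hc
      refine hdn ⟨b / c, ?_⟩
      rw [div_pow, eq_div_iff (pow_ne_zero n hc0), ← hc, hb])
  have hcard : Fintype.card (Fin n ⊕ {j : Fin n // j ≠ i₁ ∧ j ≠ i₂}) = 2 * n - 2 := by
    have h2 : Fintype.card {j : Fin n // j ≠ i₁ ∧ j ≠ i₂} = n - 2 := by
      rw [Fintype.card_subtype, show (Finset.univ.filter fun j : Fin n => j ≠ i₁ ∧ j ≠ i₂) =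
        ({i₁, i₂} : Finset (Fin n))ᶜ by ext j; simp, Finset.card_compl, Finset.card_pair h12,
        Fintype.card_fin]
    rw [Fintype.card_sum, h2, Fintype.card_fin]
    omega
  rwa [hcard] at key

end ConnectedConfigurations

/-! ### Five points of the projective plane -/

section Plane

variable {K : Type*} [Field K]

/-- The standard frame of the projective plane followed by the point `(1, ω, ω²)`. -/
def planeConfig (ω : K) : Fin 5 → Fin 3 → K
  | 0 => ![1, 0, 0]
  | 1 => ![0, 1, 0]
  | 2 => ![0, 0, 1]
  | 3 => ![1, 1, 1]
  | 4 => ![1, ω, ω ^ 2]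

theorem planeConfig_ne_zero (ω : K) (o : Fin 5) : planeConfig ω o ≠ 0 := by
  intro h
  have h0 := congrFun h 0
  have h1 := congrFun h 1
  have h2 := congrFun h 2
  fin_cases o <;> simp [planeConfig] at h0 h1 h2

theorem mulVec_fin_three_eq_smul {a b c d e f g h i x y z x' y' z' k : K}
    (h0 : a * x + b * y + c * z = k * x') (h1 : d * x + e * y + f * z = k * y')
    (h2 : g * x + h * y + i * z = k * z') :
    !![a, b, c; d, e, f; g, h, i].mulVec ![x, y, z] = k • ![x', y', z'] := by
  ext j
  fin_cases j
  · simpa [Matrix.mulVec, dotProduct, Fin.sum_univ_three] using h0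
  · simpa [Matrix.mulVec, dotProduct, Fin.sum_univ_three] using h1
  · simpa [Matrix.mulVec, dotProduct, Fin.sum_univ_three] using h2

theorem exists_matrix_planeConfig {ω : K} (hω : ω ^ 2 + ω + 1 = 0) (o₀ : Fin 5) :
    ∃ M : Matrix (Fin 3) (Fin 3) K, M.det = 1 ∧ ∀ o, o ≠ o₀ →
      ∃ c : K, M.mulVec (planeConfig ω o) = c • planeConfig (ω ^ 2) o := by
  have h3 : ω ^ 3 = 1 := by linear_combination (ω - 1) * hω
  match o₀ with
  | 0 =>
    refine ⟨!![1, 0, 0; -ω, -ω ^ 2, 0; -ω ^ 2, 0, -ω], by rw [Matrix.det_fin_three]; simp; linear_combination h3, fun o ho => ?_⟩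
    match o with
    | 0 => exact absurd rfl ho
    | 1 => exact ⟨-ω ^ 2, mulVec_fin_three_eq_smul (by grind) (by grind) (by grind)⟩
    | 2 => exact ⟨-ω, mulVec_fin_three_eq_smul (by grind) (by grind) (by grind)⟩
    | 3 => exact ⟨1, mulVec_fin_three_eq_smul (by grind) (by grind) (by grind)⟩
    | 4 => exact ⟨1, mulVec_fin_three_eq_smul (by grind) (by grind) (by grind)⟩
  | 1 =>
    refine ⟨!![-ω, -ω ^ 2, 0; 0, 1, 0; 0, -ω, -ω ^ 2], by rw [Matrix.det_fin_three]; simp; linear_combination h3, fun o ho => ?_⟩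
    match o with
    | 0 => exact ⟨-ω, mulVec_fin_three_eq_smul (by grind) (by grind) (by grind)⟩
    | 1 => exact absurd rfl ho
    | 2 => exact ⟨-ω ^ 2, mulVec_fin_three_eq_smul (by grind) (by grind) (by grind)⟩
    | 3 => exact ⟨1, mulVec_fin_three_eq_smul (by grind) (by grind) (by grind)⟩
    | 4 => exact ⟨ω ^ 2, mulVec_fin_three_eq_smul (by grind) (by grind) (by grind)⟩
  | 2 =>
    refine ⟨!![-ω ^ 2, 0, -ω; 0, -ω, -ω ^ 2; 0, 0, 1], by rw [Matrix.det_fin_three]; simp; linear_combination h3, fun o ho => ?_⟩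
    match o with
    | 0 => exact ⟨-ω ^ 2, mulVec_fin_three_eq_smul (by grind) (by grind) (by grind)⟩
    | 1 => exact ⟨-ω, mulVec_fin_three_eq_smul (by grind) (by grind) (by grind)⟩
    | 2 => exact absurd rfl ho
    | 3 => exact ⟨1, mulVec_fin_three_eq_smul (by grind) (by grind) (by grind)⟩
    | 4 => exact ⟨ω, mulVec_fin_three_eq_smul (by grind) (by grind) (by grind)⟩
  | 3 =>
    refine ⟨!![1, 0, 0; 0, ω, 0; 0, 0, ω ^ 2], by rw [Matrix.det_fin_three]; simp; linear_combination h3, fun o ho => ?_⟩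
    match o with
    | 0 => exact ⟨1, mulVec_fin_three_eq_smul (by grind) (by grind) (by grind)⟩
    | 1 => exact ⟨ω, mulVec_fin_three_eq_smul (by grind) (by grind) (by grind)⟩
    | 2 => exact ⟨ω ^ 2, mulVec_fin_three_eq_smul (by grind) (by grind) (by grind)⟩
    | 3 => exact absurd rfl ho
    | 4 => exact ⟨1, mulVec_fin_three_eq_smul (by grind) (by grind) (by grind)⟩
  | 4 =>
    refine ⟨1, Matrix.det_one, fun o ho => ⟨1, ?_⟩⟩
    rw [Matrix.one_mulVec, one_smul]
    match o with
    | 0 => rfl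
    | 1 => rfl
    | 2 => rfl
    | 3 => rfl
    | 4 => exact absurd rfl ho

theorem gammaL_eq_smul_of_frame {n : ℕ} [NeZero n] (f : GammaL K (Fin n → K)) {d : K}
    (h : ∀ i, f.1 (Pi.single i 1) = d • (Pi.single i 1 : Fin n → K)) (x : Fin n → K) :
    f.1 x = d • (fieldAutToGammaL K n (gammaAut K _ f)).1 x := by
  have hM : gammaMatrix f = d • 1 := by
    ext i j
    rw [gammaMatrix, Matrix.of_apply, h]
    simp [Matrix.one_apply, Pi.single_apply]
  rw [gammaL_apply_eq_mulVec, hM, Matrix.smul_mulVec, Matrix.one_mulVec]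
  rfl

theorem planeConfig_rigid {ω : K} (f : GammaL K (Fin 3 → K))
    (hf : ∀ o, ∃ c : K, f.1 (planeConfig ω o) = c • planeConfig (ω ^ 2) o) :
    gammaAut K _ f ω = ω ^ 2 ∧
      (f : PGammaL K (Fin 3 → K)) = fieldAutToGammaL K 3 (gammaAut K _ f) := by
  choose c hc using hf
  have hcfg : ∀ (η : K) (i : Fin 3), planeConfig η (Fin.castLE (by omega) i) = Pi.single i 1 := by
    intro η i
    ext j
    fin_cases i <;> fin_cases j <;> simp [planeConfig]
  have hs : ∀ η : K, planeConfig η 3 = unitSum K Finset.univ := by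
    intro η
    ext j
    fin_cases j <;> simp [planeConfig, unitSum]
  have he : ∀ i : Fin 3, f.1 (Pi.single i 1) =
      c (Fin.castLE (by omega) i) • (Pi.single i 1 : Fin 3 → K) := by
    intro i
    have := hc (Fin.castLE (by omega) i)
    rwa [hcfg, hcfg] at this
  have hscal := gammaL_frame_scalar f Finset.univ (fun i => c (Fin.castLE (by omega) i)) (c 3)
    (fun i _ => he i) (by have := hc 3; rwa [hs, hs] at this)
  have hfr := gammaL_eq_smul_of_frame f (d := c 3) fun i => by
    rw [he, hscal i (Finset.mem_univ i)]
  have hd : c 3 ≠ 0 := by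
    intro h0
    refine GammaL.map_ne_zero f (planeConfig_ne_zero ω 3) ?_
    rw [hc 3, h0, zero_smul]
  refine ⟨?_, mk_eq_mk_of_smul hd hfr⟩
  have h4 := hc 4
  rw [hfr] at h4
  have h0 : c 3 * gammaAut K _ f 1 = c 4 * 1 := congrFun h4 0
  have h1 : c 3 * gammaAut K _ f ω = c 4 * ω ^ 2 := congrFun h4 1
  rw [map_one, mul_one, mul_one] at h0
  rw [h0] at h1
  exact mul_left_cancel₀ (h0 ▸ hd) h1

/-- The `P`-images of the configurations for `ω` and `ω ^ 2` agree under `PSL` after any omission.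
Only a `P`-conjugate of a field automorphism squaring `ω` can match them completely. -/
theorem five_le_relationalComplexity_or {G : Subgroup (PGammaL K (Fin 3 → K))}
    (hG : PSL K (Fin 3 → K) ≤ G) {ω : K} (hω : ω ^ 2 + ω + 1 = 0)
    (P : (Fin 3 → K) ≃ₗ[K] (Fin 3 → K)) :
    ((5 : ℕ) : ℕ∞) ≤ relationalComplexity G (ℙ K (Fin 3 → K)) ∨
      ∃ ρ : K ≃+* K, ρ ω = ω ^ 2 ∧
        ((linearToGammaL K _ P * fieldAutToGammaL K 3 ρ * (linearToGammaL K _ P)⁻¹ :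
          GammaL K (Fin 3 → K)) : PGammaL K (Fin 3 → K)) ∈ G := by
  by_contra hcon
  push Not at hcon
  obtain ⟨hlt, hρ⟩ := hcon
  refine absurd ?_ (not_le.mpr hlt)
  have hne : ∀ η : K, ∀ o, P (planeConfig η o) ≠ 0 := fun η o =>
    (map_ne_zero_iff P P.injective).mpr (planeConfig_ne_zero η o)
  have key := card_le_relationalComplexity_of_vectors G (fun o => P (planeConfig ω o))
    (fun o => P (planeConfig (ω ^ 2) o)) (hne ω) (hne (ω ^ 2))
    (fun o₀ => by
      obtain ⟨M, hM, hMo⟩ := exists_matrix_planeConfig hω o₀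
      have hMdet : LinearMap.det (Matrix.toLin' M) ≠ 0 := by
        rw [LinearMap.det_toLin', hM]
        exact one_ne_zero
      let T := LinearMap.equivOfDetNeZero (Matrix.toLin' M) hMdet
      have hT : ∀ x, T x = M.mulVec x := fun x => Matrix.toLin'_apply M x
      refine ⟨_, hG (linear_mem_PSL (P.symm.trans (T.trans P)) one_ne_zero ?_), fun o ho => ?_⟩
      · have : LinearMap.det (T : (Fin 3 → K) →ₗ[K] (Fin 3 → K)) = 1 :=
          (LinearMap.det_toLin' M).trans hM
        rw [one_pow, ← this]
        exact LinearMap.det_conj (T : (Fin 3 → K) →ₗ[K] (Fin 3 → K)) P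
      · obtain ⟨c, hc⟩ := hMo o ho
        refine ⟨c, ?_⟩
        change P (T (P.symm (P (planeConfig ω o)))) = _
        rw [LinearEquiv.symm_apply_apply, hT, hc, map_smul])
    (fun f hfG hf => by
      set p := linearToGammaL K _ P with hp
      obtain ⟨h1, h2⟩ := planeConfig_rigid (p⁻¹ * f * p) fun o => by
        obtain ⟨c, hc⟩ := hf o
        refine ⟨c, ?_⟩
        change P.symm (f.1 (P (planeConfig ω o))) = _
        rw [hc, map_smul, LinearEquiv.symm_apply_apply]
      refine hρ _ h1 ?_
      rw [QuotientGroup.mk_mul, QuotientGroup.mk_mul, ← h2, ← QuotientGroup.mk_mul,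
        ← QuotientGroup.mk_mul]
      convert hfG using 2
      group)
  simpa using key

theorem PGL_le_or_five_le_relationalComplexity [Finite K] {G : Subgroup (PGammaL K (Fin 3 → K))}
    (hG : PSL K (Fin 3 → K) ≤ G) :
    PGL K (Fin 3 → K) ≤ G ∨ ((5 : ℕ) : ℕ∞) ≤ relationalComplexity G (ℙ K (Fin 3 → K)) := by
  by_cases hcube : ∀ x : K, x ^ 3 = 1 → x = 1
  · left
    -- Without nontrivial cube roots of unity every element is a cube, so `PSL` already equals
    -- `PGL`.
    refine PGL_le_of_det hG fun d hd => ⟨1, G.one_mem, ?_⟩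
    have hinj : Function.Injective fun u : Kˣ => u ^ 3 := by
      intro u v huv
      have h1 : (u / v) ^ 3 = 1 := by
        rw [div_pow, div_eq_one]
        exact huv
      have h2 := hcube ((u / v : Kˣ) : K) (by rw [← Units.val_pow_eq_pow_val, h1, Units.val_one])
      exact div_eq_one.mp (Units.ext h2)
    obtain ⟨c, hc⟩ := Finite.surjective_of_injective hinj (Units.mk0 d hd)
    refine ⟨c, c.ne_zero, ?_⟩
    have h3 : (c : K) ^ 3 = d := by
      rw [← Units.val_pow_eq_pow_val]
      exact congrArg Units.val hc
    rw [h3, ← LinearEquiv.coe_det]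
    simp
  · push Not at hcube
    obtain ⟨ω, hω3, hω1⟩ := hcube
    have hω : ω ^ 2 + ω + 1 = 0 := by
      refine (mul_eq_zero.mp (?_ : (ω - 1) * (ω ^ 2 + ω + 1) = 0)).resolve_left
        (sub_ne_zero.mpr hω1)
      linear_combination hω3
    by_contra hcon
    push Not at hcon
    obtain ⟨hPGL, hlt⟩ := hcon
    obtain ⟨g, hg⟩ := IsCyclic.exists_generator (α := Kˣ)
    have hg0 : (g : K) ≠ 0 := g.ne_zero
    obtain ⟨P, -, hP⟩ := exists_dilation_coord ((g : K) - 1) (0 : Fin 3) (Pi.single 0 1)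
      (by simp)
    have hP : LinearMap.det (P : (Fin 3 → K) →ₗ[K] (Fin 3 → K)) = g := by rw [hP]; simp
    -- The frame is used as it stands and then moved by a map of determinant `g`, a generator of the
    -- multiplicative group. The commutator of the two resulting elements of `G` is linear, and its
    -- determinant modulo cubes will be that of `g⁻¹`.
    obtain ⟨ρ, hρ, hρG⟩ := (five_le_relationalComplexity_or hG hω 1).resolve_left (not_le.mpr hlt)
    obtain ⟨τ, hτ, hτG⟩ := (five_le_relationalComplexity_or hG hω P).resolve_left (not_le.mpr hlt)
    rw [map_one, one_mul, inv_one, mul_one] at hρG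
    set A := fieldAutToGammaL K 3 ρ with hA
    set p := linearToGammaL K (Fin 3 → K) P with hp
    set B := p * fieldAutToGammaL K 3 τ * p⁻¹ with hB
    have hpaut : gammaAut K _ p = 1 := gammaAut_linear P
    have hBaut : gammaAut K _ B = τ := by
      rw [hB, map_mul, map_mul, map_inv, hpaut, gammaAut_fieldAut, one_mul, inv_one, mul_one]
    obtain ⟨u, hu⟩ : ∃ u, gammaDet B = u := ⟨_, rfl⟩
    have hu0 : u ≠ 0 := hu ▸ gammaDet_ne_zero B
    have hu1 : u * τ g = g := by
      have h1 : gammaDet (B * p) = u * τ g := by rw [gammaDet_mul, hBaut, hu, hp, gammaDet_linear, hP]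
      have h2 : gammaDet (p * fieldAutToGammaL K 3 τ) = g := by
        rw [gammaDet_mul, gammaDet_fieldAut, map_one, mul_one, hp, gammaDet_linear, hP]
      rw [← h1, ← h2, hB, inv_mul_cancel_right]
    clear_value B
    have hcomm : ρ * τ = τ * ρ := by
      obtain ⟨a, ha⟩ := exists_ringAut_eq_pow ρ
      obtain ⟨b, hb⟩ := exists_ringAut_eq_pow τ
      ext x
      change ρ (τ x) = τ (ρ x)
      rw [ha, hb, hb, ha, pow_right_comm]
    obtain ⟨T, hT⟩ := exists_linear_of_gammaAut_eq_one (A * B * (B * A)⁻¹) (by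
      rw [map_mul, map_inv, map_mul, map_mul, hBaut, hA, gammaAut_fieldAut, hcomm, mul_inv_cancel])
    have hTG : (linearToGammaL K _ T : PGammaL K (Fin 3 → K)) ∈ G := by
      rw [hT]
      exact G.mul_mem (G.mul_mem hρG hτG) (G.inv_mem (G.mul_mem hτG hρG))
    have hTdet : LinearMap.det (T : (Fin 3 → K) →ₗ[K] (Fin 3 → K)) * u = ρ u := by
      have h1 : gammaDet (linearToGammaL K _ T * (B * A)) = gammaDet (A * B) := by
        rw [hT, inv_mul_cancel_right]
      rw [gammaDet_mul, gammaDet_mul, gammaDet_mul, gammaAut_linear, gammaDet_linear, hA,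
        gammaDet_fieldAut, gammaAut_fieldAut, map_one, mul_one, one_mul, hu] at h1
      exact h1
    -- An automorphism squaring `ω` has exponent `2` modulo `3`, so it inverts classes modulo cubes.
    have hmod : ∀ σ : K ≃+* K, σ ω = ω ^ 2 → ∃ a : ℕ, ∀ x : K, σ x = x ^ (3 * a + 2) := by
      intro σ hσ
      obtain ⟨m, hm⟩ := exists_ringAut_eq_pow σ
      refine ⟨m / 3, fun x => ?_⟩
      have hm3 : m % 3 = 2 := by
        have h1 : ω ^ (m % 3) = ω ^ 2 := by
          rw [← hσ, hm, ← Nat.mod_add_div m 3, pow_add, pow_mul, hω3, one_pow, mul_one,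
            Nat.mod_add_div]
        have hω0 : ω ≠ 0 := by
          rintro rfl
          simp at hω3
        have : m % 3 < 3 := Nat.mod_lt _ (by norm_num)
        interval_cases h : m % 3
        · exfalso
          apply hω1
          calc ω = ω ^ 3 * ω := by rw [hω3, one_mul]
            _ = ω ^ 2 * ω ^ 2 := by ring
            _ = 1 := by rw [← h1]; ring
        · exfalso
          apply hω1
          apply mul_left_cancel₀ hω0
          linear_combination -h1
        · rfl
      rw [hm]
      congr 1
      omega
    obtain ⟨a, ha⟩ := hmod ρ hρ
    obtain ⟨b, hb⟩ := hmod τ hτ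
    rw [ha] at hTdet
    rw [hb] at hu1
    refine hPGL (PGL_le_of_det hG fun d hd => ?_)
    obtain ⟨k, hk⟩ := Subgroup.mem_zpowers_iff.mp (hg (Units.mk0 d hd))
    have hk' : d = (g : K) ^ k := by
      rw [← Units.val_zpow_eq_zpow_val, hk, Units.val_mk0]
    obtain ⟨c, hc0, hc⟩ : ∃ c : K, c ≠ 0 ∧
        LinearMap.det (T : (Fin 3 → K) →ₗ[K] (Fin 3 → K)) * g = c ^ 3 := by
      have h1 : LinearMap.det (T : (Fin 3 → K) →ₗ[K] (Fin 3 → K)) = u ^ (3 * a) * u := by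
        apply mul_right_cancel₀ hu0
        rw [hTdet]
        ring
      have h2 : u * (g : K) ^ (3 * b + 1) = 1 := by
        apply mul_right_cancel₀ hg0
        linear_combination hu1
      refine ⟨u ^ a / g ^ b, div_ne_zero (pow_ne_zero _ hu0) (pow_ne_zero _ hg0), ?_⟩
      rw [h1, div_pow, eq_div_iff (pow_ne_zero _ (pow_ne_zero _ hg0))]
      linear_combination u ^ (3 * a) * h2
    refine ⟨T ^ (-k), ?_, c ^ k, zpow_ne_zero k hc0, ?_⟩
    · rw [map_zpow, QuotientGroup.mk_zpow]
      exact G.zpow_mem hTG _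
    · rw [← LinearEquiv.coe_det, map_zpow, Units.val_zpow_eq_zpow_val, LinearEquiv.coe_det,
        ← zpow_natCast, zpow_comm, zpow_natCast, ← hc, mul_zpow, ← mul_assoc,
        zpow_neg, inv_mul_cancel₀ (zpow_ne_zero k (det_linearEquiv_ne_zero T)), one_mul, hk']

end Plane

/-! ### Four points of the projective line -/

section Line

variable {K : Type*} [Field K]

/-- The standard frame of the projective line followed by the point `(1, a)`. -/
def lineConfig (a : K) : Fin 4 → Fin 2 → K
  | 0 => ![1, 0]
  | 1 => ![0, 1]
  | 2 => ![1, 1]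
  | 3 => ![1, a]

/-- The determinants of the linear maps that move all but one of the points `lineConfig a` to the
corresponding points `lineConfig a'`. -/
def lineConfigDet (a a' : K) : Fin 4 → K
  | 0 => (1 - a') / (1 - a)
  | 1 => a * (1 - a') / (a' * (1 - a))
  | 2 => a' / a
  | 3 => 1

theorem lineConfig_ne_zero (a : K) (o : Fin 4) : lineConfig a o ≠ 0 := by
  intro h
  have h0 := congrFun h 0
  have h1 := congrFun h 1
  match o with
  | 0 => simp [lineConfig] at h0
  | 1 => simp [lineConfig] at h1
  | 2 => simp [lineConfig] at h0
  | 3 => simp [lineConfig] at h0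

theorem mulVec_fin_two_eq_smul {a b c d x y x' y' k : K}
    (h0 : a * x + b * y = k * x') (h1 : c * x + d * y = k * y') :
    !![a, b; c, d].mulVec ![x, y] = k • ![x', y'] := by
  ext j
  fin_cases j
  · simpa [Matrix.mulVec, dotProduct, Fin.sum_univ_two] using h0
  · simpa [Matrix.mulVec, dotProduct, Fin.sum_univ_two] using h1

theorem exists_matrix_lineConfig {a a' : K} (ha : a ≠ 0) (ha' : a' ≠ 0) (ha1 : 1 - a ≠ 0)
    (o₀ : Fin 4) :
    ∃ M : Matrix (Fin 2) (Fin 2) K, M.det = lineConfigDet a a' o₀ ∧ ∀ o, o ≠ o₀ →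
      ∃ c : K, M.mulVec (lineConfig a o) = c • lineConfig a' o := by
  match o₀ with
  | 0 =>
    refine ⟨!![1, 0; 1 - (1 - a') / (1 - a), (1 - a') / (1 - a)], by
      rw [Matrix.det_fin_two]; simp [lineConfigDet], fun o ho => ?_⟩
    match o with
    | 0 => exact absurd rfl ho
    | 1 => exact ⟨(1 - a') / (1 - a), mulVec_fin_two_eq_smul (by ring) (by ring)⟩
    | 2 => exact ⟨1, mulVec_fin_two_eq_smul (by ring) (by ring)⟩
    | 3 => exact ⟨1, mulVec_fin_two_eq_smul (by ring) (by field_simp; ring)⟩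
  | 1 =>
    refine ⟨!![a * (1 - a') / (a' * (1 - a)), 1 - a * (1 - a') / (a' * (1 - a)); 0, 1], by
      rw [Matrix.det_fin_two]; simp [lineConfigDet], fun o ho => ?_⟩
    match o with
    | 0 => exact ⟨a * (1 - a') / (a' * (1 - a)), mulVec_fin_two_eq_smul (by ring) (by ring)⟩
    | 1 => exact absurd rfl ho
    | 2 => exact ⟨1, mulVec_fin_two_eq_smul (by ring) (by ring)⟩
    | 3 => exact ⟨a / a', mulVec_fin_two_eq_smul (by field_simp; ring) (by field_simp; ring)⟩
  | 2 =>
    refine ⟨!![1, 0; 0, a' / a], by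
      rw [Matrix.det_fin_two]; simp [lineConfigDet], fun o ho => ?_⟩
    match o with
    | 0 => exact ⟨1, mulVec_fin_two_eq_smul (by ring) (by ring)⟩
    | 1 => exact ⟨a' / a, mulVec_fin_two_eq_smul (by ring) (by ring)⟩
    | 2 => exact absurd rfl ho
    | 3 => exact ⟨1, mulVec_fin_two_eq_smul (by ring) (by field_simp; ring)⟩
  | 3 =>
    refine ⟨1, Matrix.det_one, fun o ho => ⟨1, ?_⟩⟩
    rw [Matrix.one_mulVec, one_smul]
    match o with
    | 0 => rfl
    | 1 => rfl
    | 2 => rfl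
    | 3 => exact absurd rfl ho

theorem lineConfig_rigid {a a' : K} (f : GammaL K (Fin 2 → K))
    (hf : ∀ o, ∃ c : K, f.1 (lineConfig a o) = c • lineConfig a' o) :
    gammaAut K _ f a = a' ∧
      (f : PGammaL K (Fin 2 → K)) = fieldAutToGammaL K 2 (gammaAut K _ f) := by
  choose c hc using hf
  have hcfg : ∀ (η : K) (i : Fin 2), lineConfig η (Fin.castLE (by omega) i) = Pi.single i 1 := by
    intro η i
    ext j
    fin_cases i <;> fin_cases j <;> simp [lineConfig]
  have hs : ∀ η : K, lineConfig η 2 = unitSum K Finset.univ := by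
    intro η
    ext j
    fin_cases j <;> simp [lineConfig, unitSum]
  have he : ∀ i : Fin 2, f.1 (Pi.single i 1) =
      c (Fin.castLE (by omega) i) • (Pi.single i 1 : Fin 2 → K) := by
    intro i
    have := hc (Fin.castLE (by omega) i)
    rwa [hcfg, hcfg] at this
  have hscal := gammaL_frame_scalar f Finset.univ (fun i => c (Fin.castLE (by omega) i)) (c 2)
    (fun i _ => he i) (by have := hc 2; rwa [hs, hs] at this)
  have hfr := gammaL_eq_smul_of_frame f (d := c 2) fun i => by
    rw [he, hscal i (Finset.mem_univ i)]
  have hd : c 2 ≠ 0 := by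
    intro h0
    refine GammaL.map_ne_zero f (lineConfig_ne_zero a 2) ?_
    rw [hc 2, h0, zero_smul]
  refine ⟨?_, mk_eq_mk_of_smul hd hfr⟩
  have h3 := hc 3
  rw [hfr] at h3
  have h0 : c 2 * gammaAut K _ f 1 = c 3 * 1 := congrFun h3 0
  have h1 : c 2 * gammaAut K _ f a = c 3 * a' := congrFun h3 1
  rw [map_one, mul_one, mul_one] at h0
  rw [h0] at h1
  exact mul_left_cancel₀ (h0 ▸ hd) h1

theorem four_le_relationalComplexity_of_det {G : Subgroup (PGammaL K (Fin 2 → K))} {a a' : K}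
    (ha : a ≠ 0) (ha' : a' ≠ 0) (ha1 : 1 - a ≠ 0)
    (hdet : ∀ (T : (Fin 2 → K) ≃ₗ[K] (Fin 2 → K)) (o : Fin 4),
      LinearMap.det (T : (Fin 2 → K) →ₗ[K] (Fin 2 → K)) = lineConfigDet a a' o →
        (linearToGammaL K _ T : PGammaL K (Fin 2 → K)) ∈ G) (ha1' : 1 - a' ≠ 0)
    (hne : ∀ ρ : K ≃+* K, ρ a = a' → (fieldAutToGammaL K 2 ρ : PGammaL K (Fin 2 → K)) ∉ G) :
    4 ≤ relationalComplexity G (ℙ K (Fin 2 → K)) := by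
  have key := card_le_relationalComplexity_of_vectors G (lineConfig a) (lineConfig a')
    (lineConfig_ne_zero a) (lineConfig_ne_zero a')
    (fun o₀ => by
      obtain ⟨M, hM, hMo⟩ := exists_matrix_lineConfig ha ha' ha1 o₀
      have hMdet : LinearMap.det (Matrix.toLin' M) ≠ 0 := by
        rw [LinearMap.det_toLin', hM]
        match o₀ with
        | 0 => exact div_ne_zero ha1' ha1
        | 1 => exact div_ne_zero (mul_ne_zero ha ha1') (mul_ne_zero ha' ha1)
        | 2 => exact div_ne_zero ha' ha
        | 3 => exact one_ne_zero
      refine ⟨_, hdet (LinearMap.equivOfDetNeZero (Matrix.toLin' M) hMdet) o₀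
        ((LinearMap.det_toLin' M).trans hM), hMo⟩)
    (fun f hfG hf => by
      obtain ⟨h1, h2⟩ := lineConfig_rigid f hf
      exact hne _ h1 (h2 ▸ hfG))
  simpa using key

/-- All four determinants are built from the ratios `a' / a` and `(1 - a') / (1 - a)`. When both are
squares, every map between triples lies in `PSL`. -/
theorem four_le_relationalComplexity_of_sq {G : Subgroup (PGammaL K (Fin 2 → K))}
    (hG : PSL K (Fin 2 → K) ≤ G) {a a' c d : K} (ha : a ≠ 0) (ha' : a' ≠ 0) (ha1 : 1 - a ≠ 0)
    (ha1' : 1 - a' ≠ 0) (hc : a' = a * c ^ 2) (hd : 1 - a' = (1 - a) * d ^ 2)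
    (hne : ∀ ρ : K ≃+* K, ρ a = a' → (fieldAutToGammaL K 2 ρ : PGammaL K (Fin 2 → K)) ∉ G) :
    4 ≤ relationalComplexity G (ℙ K (Fin 2 → K)) := by
  have hc0 : c ≠ 0 := by
    rintro rfl
    simp [ha'] at hc
  have hd0 : d ≠ 0 := by
    rintro rfl
    simp [ha1'] at hd
  refine four_le_relationalComplexity_of_det ha ha' ha1 (fun T o hT => hG ?_) ha1' hne
  have hx : ∃ x : K, x ≠ 0 ∧ lineConfigDet a a' o = x ^ 2 := by
    match o with
    | 0 => exact ⟨d, hd0, by rw [lineConfigDet, hd, mul_div_cancel_left₀ _ ha1]⟩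
    | 1 =>
      refine ⟨d / c, div_ne_zero hd0 hc0, ?_⟩
      rw [lineConfigDet, hd, hc]
      field_simp
    | 2 => exact ⟨c, hc0, by rw [lineConfigDet, hc, mul_div_cancel_left₀ _ ha]⟩
    | 3 => exact ⟨1, one_ne_zero, (one_pow 2).symm⟩
  obtain ⟨x, hx0, hx⟩ := hx
  exact linear_mem_PSL T hx0 (hT.trans hx)

theorem four_le_relationalComplexity_of_PGL_le {G : Subgroup (PGammaL K (Fin 2 → K))}
    (hG : PGL K (Fin 2 → K) ≤ G) (h : ∃ a a' : K, a ≠ 0 ∧ a' ≠ 0 ∧ 1 - a ≠ 0 ∧ 1 - a' ≠ 0 ∧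
      ∀ ρ : K ≃+* K, ρ a ≠ a') :
    4 ≤ relationalComplexity G (ℙ K (Fin 2 → K)) := by
  obtain ⟨a, a', ha, ha', ha1, ha1', hρ⟩ := h
  exact four_le_relationalComplexity_of_det ha ha' ha1 (fun T _ _ => hG (linear_mem_PGL T)) ha1'
    fun ρ h => absurd h (hρ ρ)

theorem neg_one_ne_one_of_charP_three [CharP K 3] : (-1 : K) ≠ 1 := by
  intro h
  have h3 : (3 : K) = 0 := by exact_mod_cast CharP.cast_eq_zero K 3
  exact one_ne_zero (by linear_combination h3 + h : (1 : K) = 0)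

variable [Finite K]

variable (K) in
theorem exists_card_eq_pow_and_card_ringAut_le :
    ∃ p d : ℕ, p.Prime ∧ CharP K p ∧ Nat.card K = p ^ d ∧ Nat.card (K ≃+* K) ≤ d := by
  obtain ⟨p, hp, _, f, hf, -⟩ := exists_injective_ringAut_to_galois K
  have := Fintype.ofFinite K
  refine ⟨p, Module.finrank (ZMod p) K, hp.out, charP_of_injective_algebraMap
    (algebraMap (ZMod p) K).injective p, ?_, ?_⟩
  · rw [Nat.card_eq_fintype_card, Module.card_eq_pow_finrank (K := ZMod p), ZMod.card]
  · refine (Nat.card_le_card_of_injective f hf).trans ?_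
    rw [Nat.card_eq_fintype_card]
    exact AlgEquiv.card_le (F := ZMod p) (K := K)

theorem exists_eq_mul_sq_of_isSquare_iff {x y : K} (hx : x ≠ 0) (hy : y ≠ 0)
    (h : IsSquare x ↔ IsSquare y) : ∃ c : K, y = x * c ^ 2 := by
  obtain ⟨g, hg⟩ := IsCyclic.exists_generator (α := Kˣ)
  obtain ⟨k, hk⟩ := Subgroup.mem_zpowers_iff.mp (hg (Units.mk0 x hx))
  obtain ⟨l, hl⟩ := Subgroup.mem_zpowers_iff.mp (hg (Units.mk0 y hy))
  have hk : (g : K) ^ k = x := by rw [← Units.val_zpow_eq_zpow_val, hk, Units.val_mk0]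
  have hl : (g : K) ^ l = y := by rw [← Units.val_zpow_eq_zpow_val, hl, Units.val_mk0]
  have hg0 : (g : K) ≠ 0 := g.ne_zero
  by_cases hkl : Even (l - k)
  · obtain ⟨m, hm⟩ := hkl
    refine ⟨(g : K) ^ m, ?_⟩
    rw [← hk, ← hl, ← zpow_natCast, ← zpow_mul, ← zpow_add₀ hg0]
    congr 1
    push_cast
    omega
  -- If the exponents have different parity, one of the elements is visibly a square, and the
  -- hypothesis then makes both squares.
  · have hsq : ∀ m : ℤ, Even m → IsSquare ((g : K) ^ m) := by
      rintro m ⟨r, rfl⟩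
      exact ⟨(g : K) ^ r, zpow_add₀ hg0 r r⟩
    have hboth : IsSquare x ∧ IsSquare y := by
      rcases Int.even_or_odd k with he | ho
      · have h1 : IsSquare x := hk ▸ hsq k he
        exact ⟨h1, h.mp h1⟩
      · have hle : Even l := by
          rw [Int.even_sub, not_iff] at hkl
          rcases Int.even_or_odd l with hl | hl
          · exact hl
          · exact absurd (hkl.mp (Int.not_even_iff_odd.mpr hl)) (Int.not_even_iff_odd.mpr ho)
        have h1 : IsSquare y := hl ▸ hsq l hle
        exact ⟨h.mpr h1, h1⟩
    obtain ⟨⟨a, ha⟩, ⟨b, hb⟩⟩ := hboth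
    have ha0 : a ≠ 0 := by
      rintro rfl
      exact hx (by simpa using ha)
    refine ⟨b / a, ?_⟩
    rw [ha, hb]
    field_simp

/-- Pigeonhole: otherwise each joint square class of `x` and `1 - x` lies in one orbit of the
automorphism group, of size at most `r` with `q = p ^ r`. There are at most four classes, and one in
characteristic two, so `q - 2 ≤ 4 r` or `q - 2 ≤ r`. Both fail for the `q` allowed here. -/
theorem exists_same_square_class_not_conjugate (h8 : 8 ≤ Nat.card K) (h9 : Nat.card K ≠ 9)
    (hAut : 1 < Nat.card (K ≃+* K)) :
    ∃ a a' c d : K, a ≠ 0 ∧ a' ≠ 0 ∧ 1 - a ≠ 0 ∧ 1 - a' ≠ 0 ∧ a' = a * c ^ 2 ∧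
      1 - a' = (1 - a) * d ^ 2 ∧ ∀ ρ : K ≃+* K, ρ a ≠ a' := by
  classical
  have := Fintype.ofFinite K
  have := Fintype.ofFinite (K ≃+* K)
  obtain ⟨p, r, hp, hchar, hq, hr⟩ := exists_card_eq_pow_and_card_ringAut_le K
  by_contra hcon
  push Not at hcon
  let S : Finset K := {0, 1}ᶜ
  have hS : ∀ x, x ∈ S ↔ x ≠ 0 ∧ x ≠ 1 := fun x => by simp [S]
  have hScard : S.card = Nat.card K - 2 := by
    rw [Finset.card_compl, Finset.card_pair zero_ne_one, Nat.card_eq_fintype_card]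
  let κ : K → Bool × Bool := fun x => (decide (IsSquare x), decide (IsSquare (1 - x)))
  have hfib : ∀ b ∈ S.image κ, (S.filter fun x => κ x = b).card ≤ r := by
    intro b hb
    obtain ⟨a, ha, rfl⟩ := Finset.mem_image.mp hb
    obtain ⟨ha0, ha1⟩ := (hS a).mp ha
    have hsub : (S.filter fun x => κ x = κ a) ⊆
        (Finset.univ : Finset (K ≃+* K)).image fun ρ => ρ a := by
      intro x hx
      obtain ⟨hxS, hxa⟩ := Finset.mem_filter.mp hx
      obtain ⟨hx0, hx1⟩ := (hS x).mp hxS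
      obtain ⟨h1, h2⟩ := Prod.mk.inj hxa
      have ha1' : 1 - a ≠ 0 := sub_ne_zero.mpr ha1.symm
      have hx1' : 1 - x ≠ 0 := sub_ne_zero.mpr hx1.symm
      obtain ⟨c, hc⟩ := exists_eq_mul_sq_of_isSquare_iff ha0 hx0 (decide_eq_decide.mp h1).symm
      obtain ⟨d, hd⟩ := exists_eq_mul_sq_of_isSquare_iff ha1' hx1' (decide_eq_decide.mp h2).symm
      obtain ⟨ρ, hρ⟩ := hcon a x c d ha0 hx0 ha1' hx1' hc hd
      exact Finset.mem_image.mpr ⟨ρ, Finset.mem_univ _, hρ⟩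
    refine (Finset.card_le_card hsub).trans (Finset.card_image_le.trans ?_)
    rwa [Finset.card_univ, ← Nat.card_eq_fintype_card]
  have hle := Finset.card_le_mul_card_image S r hfib
  rw [hScard] at hle
  have hr2 : 2 ≤ r := by omega
  rcases hp.eq_two_or_odd with rfl | hodd
  · have him : (S.image κ).card ≤ 1 := by
      rw [Finset.card_le_one]
      have hsq : ∀ x : K, IsSquare x :=
        fun x => FiniteField.isSquare_of_char_two (ringChar.eq_iff.mpr hchar) x
      have hκ : ∀ x, κ x = (true, true) := fun x => by simp [κ, hsq]
      intro x hx y hy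
      obtain ⟨x, -, rfl⟩ := Finset.mem_image.mp hx
      obtain ⟨y, -, rfl⟩ := Finset.mem_image.mp hy
      rw [hκ, hκ]
    have h1 : Nat.card K - 2 ≤ r := hle.trans (by nlinarith)
    rw [hq] at h1 h8
    have hr3 : 3 ≤ r := by
      by_contra hlt
      interval_cases r
      norm_num at h8
    have h2 : ∀ m : ℕ, 3 ≤ m → m + 2 < 2 ^ m := by
      intro m hm
      induction m, hm using Nat.le_induction with
      | base => norm_num
      | succ m hm ih => rw [pow_succ]; omega
    have := h2 r hr3
    omega
  · have him : (S.image κ).card ≤ 4 := (Finset.card_le_univ _).trans (by simp)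
    have h1 : Nat.card K - 2 ≤ 4 * r := hle.trans (by nlinarith)
    rw [hq] at h1 h9
    have hp3 : 3 ≤ p := by
      have := hp.two_le
      omega
    rcases hr2.eq_or_lt with rfl | hr3
    · have hp5 : 5 ≤ p := by
        by_contra hlt
        have : p = 3 := by omega
        subst this
        norm_num at h9
      have : 25 ≤ p ^ 2 := by nlinarith
      omega
    · have h2 : ∀ m : ℕ, 3 ≤ m → 4 * m + 2 < 3 ^ m := by
        intro m hm
        induction m, hm using Nat.le_induction with
        | base => norm_num
        | succ m hm ih => rw [pow_succ]; omega
      have h3 := h2 r hr3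
      have h4 : 3 ^ r ≤ p ^ r := Nat.pow_le_pow_left hp3 r
      omega

theorem charP_three_of_card_eq_nine (h9 : Nat.card K = 9) :
    CharP K 3 ∧ Nat.card (K ≃+* K) ≤ 2 := by
  obtain ⟨p, r, hp, hchar, hq, hr⟩ := exists_card_eq_pow_and_card_ringAut_le K
  rw [h9] at hq
  have hp3 : p = 3 := by
    have hdvd : p ∣ 9 := by
      rw [hq]
      refine dvd_pow_self p ?_
      rintro rfl
      norm_num at hq
    have : p ∣ 3 ^ 2 := by norm_num; exact hdvd
    exact (Nat.prime_dvd_prime_iff_eq hp Nat.prime_three).mp (hp.dvd_of_dvd_pow this)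
  subst hp3
  have hr2 : r = 2 := by
    have : 3 ^ 2 = 3 ^ r := by rw [← hq]; norm_num
    exact (Nat.pow_right_injective (by norm_num : 2 ≤ 3) this).symm
  exact ⟨hchar, hr2 ▸ hr⟩

theorem exists_ringAut_eq_mul_sq (h : (-1 : K) ≠ 1) (σ : K ≃+* K) :
    ∃ l : ℕ, ∀ x, σ x = x * (x ^ l) ^ 2 := by
  obtain ⟨m, hm⟩ := exists_ringAut_eq_pow σ
  have hodd : Odd m := by
    rw [← Nat.not_even_iff_odd]
    intro he
    have h' := hm (-1)
    rw [he.neg_one_pow, map_neg, map_one] at h'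
    exact h h'
  obtain ⟨l, rfl⟩ := hodd
  exact ⟨l, fun x => by rw [hm]; ring⟩

theorem four_le_relationalComplexity_of_card_eq_nine (h9 : Nat.card K = 9)
    (hAut : 1 < Nat.card (K ≃+* K)) {G : Subgroup (PGammaL K (Fin 2 → K))}
    (hG : PSL K (Fin 2 → K) ≤ G) (hne : G ≠ PSigmaL K 2) :
    4 ≤ relationalComplexity G (ℙ K (Fin 2 → K)) := by
  classical
  obtain ⟨hchar, hAut2⟩ := charP_three_of_card_eq_nine h9
  have := Fintype.ofFinite K
  have htwo : (-1 : K) ≠ 1 := neg_one_ne_one_of_charP_three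
  by_cases hPGL : PGL K (Fin 2 → K) ≤ G
  · refine four_le_relationalComplexity_of_PGL_le hPGL ?_
    obtain ⟨a', ha'⟩ : ∃ a' : K, a' ∉ ({0, 1, -1} : Finset K) := by
      by_contra hall
      push Not at hall
      have h1 : (Finset.univ : Finset K).card ≤ ({0, 1, -1} : Finset K).card :=
        Finset.card_le_card fun x _ => hall x
      have h2 : ({0, 1, -1} : Finset K).card ≤ 3 := Finset.card_le_three
      rw [Finset.card_univ, ← Nat.card_eq_fintype_card, h9] at h1
      omega
    simp only [Finset.mem_insert, Finset.mem_singleton, not_or] at ha'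
    refine ⟨-1, a', by simp, ha'.1, sub_ne_zero.mpr htwo.symm, sub_ne_zero.mpr (Ne.symm ha'.2.1),
      fun ρ => ?_⟩
    rw [map_neg, map_one]
    exact Ne.symm ha'.2.2
  · obtain ⟨ζ, hζ⟩ := exists_generator_fixed_only_by_one (K := K)
    obtain ⟨τ, hτ⟩ : ∃ τ : K ≃+* K, τ ≠ 1 := by
      have := (Finite.one_lt_card_iff_nontrivial).mp hAut
      exact exists_ne 1
    have hτζ : τ ζ ≠ ζ := fun h => hτ (hζ τ h)
    have hz0 : ζ ≠ 0 := by rintro rfl; simp at hτζ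
    have hz1 : 1 - ζ ≠ 0 := by
      intro h
      rw [← sub_eq_zero.mp h] at hτζ
      simp at hτζ
    obtain ⟨l, hsq⟩ := exists_ringAut_eq_mul_sq htwo τ
    refine four_le_relationalComplexity_of_sq hG hz0 (by simpa using hz0) hz1 ?_ (hsq ζ)
      (by rw [← hsq, map_sub, map_one]) fun ρ hρ hρG => ?_
    · rw [← map_one τ, ← map_sub]
      exact fun h => hz1 ((map_eq_zero τ).mp h)
    -- The only automorphism taking `ζ` to `τ ζ` is `τ`. If it lay in `G` then `PΣL` would too, as
    -- there are at most two automorphisms; being strictly larger, `G` would contain a linear map of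
    -- nonsquare determinant and hence `PGL`.
    have hρτ : ρ = τ := by
      have := hζ (τ⁻¹ * ρ) (by
        change τ.symm (ρ ζ) = ζ
        rw [hρ, RingEquiv.symm_apply_apply])
      exact (inv_mul_eq_one.mp this).symm
    subst hρτ
    have hfield : ∀ σ : K ≃+* K, (fieldAutToGammaL K 2 σ : PGammaL K (Fin 2 → K)) ∈ G := by
      intro σ
      by_cases h1 : σ = 1
      · rw [h1, map_one]
        exact G.one_mem
      by_cases h2 : σ = ρ
      · rwa [h2]
      exfalso
      have := Fintype.ofFinite (K ≃+* K)
      have h3 : ({1, σ, ρ} : Finset (K ≃+* K)).card = 3 :=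
        Finset.card_eq_three.mpr ⟨1, σ, ρ, Ne.symm h1, Ne.symm hτ, h2, rfl⟩
      have h4 := Finset.card_le_univ ({1, σ, ρ} : Finset (K ≃+* K))
      rw [Nat.card_eq_fintype_card] at hAut2
      omega
    have hle : PSigmaL K 2 ≤ G := by
      rw [PSigmaL, Subgroup.map_le_iff_le_comap]
      refine sup_le (fun f hf => hG ⟨f, hf, rfl⟩) ?_
      rintro _ ⟨σ, rfl⟩
      exact hfield σ
    obtain ⟨g, hg, hgS⟩ := SetLike.not_le_iff_exists.mp fun h => hne (le_antisymm h hle)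
    obtain ⟨f, rfl⟩ := QuotientGroup.mk_surjective g
    rw [mem_PSigmaL_iff] at hgS
    obtain ⟨T, hT⟩ := exists_linear_mul_fieldAut f
    have hTG : (linearToGammaL K _ T : PGammaL K (Fin 2 → K)) ∈ G := by
      rw [eq_mul_inv_of_mul_eq hT.symm]
      exact G.mul_mem hg (G.inv_mem (hfield _))
    have hTdet : gammaDet f = LinearMap.det (T : (Fin 2 → K) →ₗ[K] (Fin 2 → K)) := by
      rw [hT, gammaDet_mul, gammaDet_fieldAut, map_one, mul_one, gammaDet_linear]
    rw [hTdet] at hgS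
    refine hPGL (PGL_le_of_det hG fun d hd => ?_)
    by_cases hdsq : IsSquare d
    · obtain ⟨c, rfl⟩ := hdsq
      have hc : c ≠ 0 := by
        rintro rfl
        simp at hd
      refine ⟨1, by rw [map_one]; exact G.one_mem, c, hc, ?_⟩
      rw [← LinearEquiv.coe_det, map_one, Units.val_one, one_mul, pow_two]
    · have hTsq : ¬ IsSquare (LinearMap.det (T : (Fin 2 → K) →ₗ[K] (Fin 2 → K))) := by
        rintro ⟨c, hc⟩
        exact hgS ⟨c, by rw [hc, pow_two]⟩
      obtain ⟨c, hc⟩ := exists_eq_mul_sq_of_isSquare_iff (det_linearEquiv_ne_zero T) hd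
        (iff_of_false hTsq hdsq)
      refine ⟨T, hTG, c, ?_, hc⟩
      rintro rfl
      simp [hd] at hc

theorem four_le_relationalComplexity (h8 : 8 ≤ Nat.card K) (hAut : 1 < Nat.card (K ≃+* K))
    {G : Subgroup (PGammaL K (Fin 2 → K))} (hG : PSL K (Fin 2 → K) ≤ G)
    (hne : ¬ (Nat.card K = 9 ∧ G = PSigmaL K 2)) :
    4 ≤ relationalComplexity G (ℙ K (Fin 2 → K)) := by
  by_cases h9 : Nat.card K = 9
  · exact four_le_relationalComplexity_of_card_eq_nine h9 hAut hG fun h => hne ⟨h9, h⟩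
  · obtain ⟨a, a', c, d, ha, ha', ha1, ha1', hc, hd, hρ⟩ :=
      exists_same_square_class_not_conjugate h8 h9 hAut
    exact four_le_relationalComplexity_of_sq hG ha ha' ha1 ha1' hc hd
      fun ρ h => absurd h (hρ ρ)

end Line

/-! ### The projective line over the field with nine elements -/

section NineElements

variable {K : Type*} [Field K]

/-- The determinant of a pair of vectors of `K²`. -/
def pairDet (x y : Fin 2 → K) : K := x 0 * y 1 - x 1 * y 0

/-- The fourth power of the cyclic product of the determinants of three vectors of `K²`. -/
def tripleDet (x y z : Fin 2 → K) : K := (pairDet x y * pairDet y z * pairDet z x) ^ 4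

/-- The value of `tripleDet` on representatives of three points of the projective line. -/
noncomputable def tripleInvariant (p q r : ℙ K (Fin 2 → K)) : K := tripleDet p.rep q.rep r.rep

theorem pairDet_map (f : GammaL K (Fin 2 → K)) (x y : Fin 2 → K) :
    pairDet (f.1 x) (f.1 y) = gammaDet f * gammaAut K _ f (pairDet x y) := by
  rw [gammaL_apply_eq_mulVec, gammaL_apply_eq_mulVec, gammaDet, Matrix.det_fin_two]
  simp only [pairDet, Matrix.mulVec, dotProduct, Fin.sum_univ_two, map_sub, map_mul]
  ring

theorem pairDet_smul (a b : K) (x y : Fin 2 → K) :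
    pairDet (a • x) (b • y) = a * b * pairDet x y := by
  simp only [pairDet, Pi.smul_apply, smul_eq_mul]
  ring

theorem mk_eq_mk_of_pairDet_eq_zero {x y : Fin 2 → K} (hx : x ≠ 0) (hy : y ≠ 0)
    (h : pairDet x y = 0) : Projectivization.mk K x hx = Projectivization.mk K y hy := by
  rw [Projectivization.mk_eq_mk_iff']
  have h' : x 0 * y 1 = x 1 * y 0 := sub_eq_zero.mp h
  by_cases h0 : y 0 = 0
  · have h1 : y 1 ≠ 0 := by
      intro h1
      apply hy
      ext i
      fin_cases i
      · exact h0
      · exact h1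
    refine ⟨x 1 / y 1, ?_⟩
    ext i
    fin_cases i
    · have : x 0 = 0 := by
        rw [h0, mul_zero] at h'
        exact (mul_eq_zero.mp h').resolve_right h1
      simp [h0, this]
    · simp [h1]
  · refine ⟨x 0 / y 0, ?_⟩
    ext i
    fin_cases i
    · simp [h0]
    · change x 0 / y 0 * y 1 = x 1
      field_simp
      rw [h', mul_comm]

theorem exists_linear_frame {p q r : ℙ K (Fin 2 → K)} (hpq : p ≠ q) (hqr : q ≠ r) (hpr : p ≠ r) :
    ∃ P : (Fin 2 → K) ≃ₗ[K] (Fin 2 → K), (∃ c : K, P ![1, 0] = c • p.rep) ∧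
      (∃ c : K, P ![0, 1] = c • q.rep) ∧ ∃ c : K, P ![1, 1] = c • r.rep := by
  have hdet : ∀ {s t : ℙ K (Fin 2 → K)}, s ≠ t → pairDet s.rep t.rep ≠ 0 := by
    intro s t hst h
    have := mk_eq_mk_of_pairDet_eq_zero s.rep_nonzero t.rep_nonzero h
    rw [Projectivization.mk_rep, Projectivization.mk_rep] at this
    exact hst this
  set x := p.rep
  set y := q.rep
  set z := r.rep
  have hxy := hdet hpq
  have hzy := hdet hqr.symm
  have hxz := hdet hpr
  -- By Cramer's rule `pairDet z y • x + pairDet x z • y = pairDet x y • z`, so these scaled columns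
  -- sum to a multiple of `z`.
  let M : Matrix (Fin 2) (Fin 2) K :=
    !![pairDet z y * x 0, pairDet x z * y 0; pairDet z y * x 1, pairDet x z * y 1]
  have hM : M.det = pairDet z y * pairDet x z * pairDet x y := by
    rw [Matrix.det_fin_two]
    simp only [M, Matrix.of_apply, Matrix.cons_val_zero, Matrix.cons_val_one,
      Matrix.cons_val', Matrix.cons_val_fin_one, pairDet]
    ring
  have hMdet : LinearMap.det (Matrix.toLin' M) ≠ 0 := by
    rw [LinearMap.det_toLin', hM]
    exact mul_ne_zero (mul_ne_zero hzy hxz) hxy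
  have hvec : ∀ v : Fin 2 → K, v = ![v 0, v 1] := fun v => by
    ext i
    fin_cases i <;> rfl
  refine ⟨LinearMap.equivOfDetNeZero (Matrix.toLin' M) hMdet, ⟨pairDet z y, ?_⟩,
    ⟨pairDet x z, ?_⟩, ⟨pairDet x y, ?_⟩⟩
  · change M.mulVec ![1, 0] = _
    rw [hvec x]
    exact mulVec_fin_two_eq_smul (by ring) (by ring)
  · change M.mulVec ![0, 1] = _
    rw [hvec y]
    exact mulVec_fin_two_eq_smul (by ring) (by ring)
  · change M.mulVec ![1, 1] = _
    rw [hvec z]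
    exact mulVec_fin_two_eq_smul (by simp only [pairDet]; ring) (by simp only [pairDet]; ring)

/-- In characteristic three, `x ^ 4 = x * x ^ 3` plays the role of a norm. The two equations give
`a` and `b` equal norm and equal trace `x + x ^ 3`, so `b` is a root of `(X - a) (X - a ^ 3)`. -/
theorem eq_or_eq_pow_three (h3 : (3 : K) = 0) {a b : K} (h1 : a ^ 4 = b ^ 4)
    (h2 : (a - 1) ^ 4 = (b - 1) ^ 4) : b = a ∨ b = a ^ 3 := by
  have h : (b - a) * (b - a ^ 3) = 0 := by
    linear_combination (1 - b) * h1 + b * h2 +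
      (b * a - 2 * b * a ^ 2 + b * a ^ 3 - b ^ 2 + 2 * b ^ 3 - b ^ 4) * h3
  rcases mul_eq_zero.mp h with h | h
  · exact Or.inl (sub_eq_zero.mp h)
  · exact Or.inr (sub_eq_zero.mp h)

/-- The point of the projective line with affine coordinate `a`. -/
def affinePoint (a : K) : ℙ K (Fin 2 → K) :=
  Projectivization.mk K ![1, a] fun h => one_ne_zero (congrFun h 0)

variable (K) in
/-- The point at infinity of the projective line. -/
def infinityPoint : ℙ K (Fin 2 → K) :=
  Projectivization.mk K ![0, 1] fun h => one_ne_zero (congrFun h 1)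

theorem eq_infinityPoint_or_affinePoint (p : ℙ K (Fin 2 → K)) :
    p = infinityPoint K ∨ ∃ a, p = affinePoint a := by
  induction p using Projectivization.ind with | h x hx =>
  by_cases h0 : x 0 = 0
  · left
    apply mk_eq_mk_of_pairDet_eq_zero
    simp [pairDet, h0]
  · right
    refine ⟨x 1 / x 0, ?_⟩
    apply mk_eq_mk_of_pairDet_eq_zero
    simp only [pairDet, Matrix.cons_val_zero, Matrix.cons_val_one]
    field_simp
    ring

theorem fieldAut_smul_infinityPoint (ρ : K ≃+* K) :
    fieldAutToGammaL K 2 ρ • infinityPoint K = infinityPoint K := by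
  refine (gammaL_smul_mk K _ _ _ _).trans ?_
  apply mk_eq_mk_of_pairDet_eq_zero
  change ρ 0 * 1 - ρ 1 * 0 = 0
  simp

theorem fieldAut_smul_affinePoint (ρ : K ≃+* K) (a : K) :
    fieldAutToGammaL K 2 ρ • affinePoint a = affinePoint (ρ a) := by
  refine (gammaL_smul_mk K _ _ _ _).trans ?_
  apply mk_eq_mk_of_pairDet_eq_zero
  change ρ 1 * ρ a - ρ a * 1 = 0
  simp

variable [Finite K]

theorem pow_eight_eq_one (h9 : Nat.card K = 9) {x : K} (hx : x ≠ 0) : x ^ 8 = 1 := by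
  have := Fintype.ofFinite K
  have h := FiniteField.pow_card_sub_one_eq_one x hx
  rwa [← Nat.card_eq_fintype_card, h9] at h

theorem pow_nine_eq_self (h9 : Nat.card K = 9) (x : K) : x ^ 9 = x := by
  have := Fintype.ofFinite K
  have h := FiniteField.pow_card x
  rwa [← Nat.card_eq_fintype_card, h9] at h

theorem ringEquiv_pow_four (h9 : Nat.card K = 9) (ρ : K ≃+* K) (x : K) : ρ (x ^ 4) = x ^ 4 := by
  by_cases hx : x = 0
  · simp [hx]
  have h : (x ^ 4 - 1) * (x ^ 4 + 1) = 0 := by linear_combination pow_eight_eq_one h9 hx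
  rcases mul_eq_zero.mp h with h | h
  · rw [sub_eq_zero.mp h, map_one]
  · rw [eq_neg_of_add_eq_zero_left h, map_neg, map_one]

theorem tripleDet_smul (h9 : Nat.card K = 9) {a b c : K} (ha : a ≠ 0) (hb : b ≠ 0) (hc : c ≠ 0)
    (x y z : Fin 2 → K) : tripleDet (a • x) (b • y) (c • z) = tripleDet x y z := by
  have h := pow_eight_eq_one h9 (mul_ne_zero (mul_ne_zero ha hb) hc)
  simp only [tripleDet, pairDet_smul]
  linear_combination (pairDet x y * pairDet y z * pairDet z x) ^ 4 * h

theorem tripleInvariant_mk (h9 : Nat.card K = 9) {x y z : Fin 2 → K} (hx : x ≠ 0) (hy : y ≠ 0)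
    (hz : z ≠ 0) : tripleInvariant (Projectivization.mk K x hx) (Projectivization.mk K y hy)
      (Projectivization.mk K z hz) = tripleDet x y z := by
  obtain ⟨a, ha⟩ := Projectivization.exists_smul_eq_mk_rep K x hx
  obtain ⟨b, hb⟩ := Projectivization.exists_smul_eq_mk_rep K y hy
  obtain ⟨c, hc⟩ := Projectivization.exists_smul_eq_mk_rep K z hz
  rw [tripleInvariant, ← ha, ← hb, ← hc]
  exact tripleDet_smul h9 a.ne_zero b.ne_zero c.ne_zero x y z

/-- Each of the three determinants contributes a factor `gammaDet f`, and fourth powers over nine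
elements lie in `{0, 1, -1}`, which automorphisms fix. -/
theorem tripleInvariant_smul (h9 : Nat.card K = 9) (f : GammaL K (Fin 2 → K))
    (p q r : ℙ K (Fin 2 → K)) : tripleInvariant (f • p) (f • q) (f • r) =
      gammaDet f ^ 12 * tripleInvariant p q r := by
  induction p using Projectivization.ind with | h x hx =>
  induction q using Projectivization.ind with | h y hy =>
  induction r using Projectivization.ind with | h z hz =>
  rw [gammaL_smul_mk, gammaL_smul_mk, gammaL_smul_mk, tripleInvariant_mk h9, tripleInvariant_mk h9,
    tripleDet, pairDet_map, pairDet_map, pairDet_map]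
  have h := ringEquiv_pow_four h9 (gammaAut K _ f) (pairDet x y * pairDet y z * pairDet z x)
  rw [map_pow, map_mul, map_mul] at h
  rw [tripleDet, ← h]
  ring

theorem tripleInvariant_smul_of_mem (h9 : Nat.card K = 9) {g : PGammaL K (Fin 2 → K)}
    (hg : g ∈ PSigmaL K 2) (p q r : ℙ K (Fin 2 → K)) :
    tripleInvariant (g • p) (g • q) (g • r) = tripleInvariant p q r := by
  obtain ⟨f, rfl⟩ := QuotientGroup.mk_surjective g
  obtain ⟨c, hc⟩ := (mem_PSigmaL_iff f).mp hg
  have hc0 : c ≠ 0 := by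
    rintro rfl
    exact gammaDet_ne_zero f (by simpa using hc)
  refine (tripleInvariant_smul h9 f p q r).trans ?_
  rw [hc, ← pow_mul, show 2 * 12 = 8 * 3 by norm_num, pow_mul, pow_eight_eq_one h9 hc0, one_pow,
    one_mul]

/-- An automorphism multiplies each element by a square, so the crossed determinant of the conjugate
is a square whatever `P` is. Frames may thus be normalized by all of `GL`. -/
theorem conj_fieldAut_mem_PSigmaL (h : (-1 : K) ≠ 1) (P : (Fin 2 → K) ≃ₗ[K] (Fin 2 → K))
    (ρ : K ≃+* K) :
    ((linearToGammaL K _ P * fieldAutToGammaL K 2 ρ * (linearToGammaL K _ P)⁻¹ :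
      GammaL K (Fin 2 → K)) : PGammaL K (Fin 2 → K)) ∈ PSigmaL K 2 := by
  obtain ⟨l, hl⟩ := exists_ringAut_eq_mul_sq h ρ
  set p := linearToGammaL K (Fin 2 → K) P
  rw [mem_PSigmaL_iff]
  have h1 : gammaDet (p * fieldAutToGammaL K 2 ρ * p⁻¹ * p) = gammaDet p := by
    rw [inv_mul_cancel_right, gammaDet_mul, gammaDet_fieldAut, map_one, mul_one]
  have haut : gammaAut K _ (p * fieldAutToGammaL K 2 ρ * p⁻¹) = ρ := by
    rw [map_mul, map_mul, map_inv, gammaAut_linear, gammaAut_fieldAut, one_mul, inv_one, mul_one]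
  rw [gammaDet_mul, haut, hl] at h1
  have hp := gammaDet_ne_zero p
  refine ⟨(gammaDet p ^ l)⁻¹, ?_⟩
  rw [inv_pow]
  apply eq_inv_of_mul_eq_one_left
  apply mul_right_cancel₀ hp
  linear_combination h1

/-- Coherence of Frobenius: with norms `x * x ^ 3` and `a ^ 9 = a`, the two sides differ by exactly
this product. So if one coordinate is moved and another is not, one of them lies in the prime field.
-/
theorem mul_eq_zero_of_pow_four_eq (h3 : (3 : K) = 0) (h9 : Nat.card K = 9) {a b : K}
    (h : (a - b) ^ 4 = (a ^ 3 - b) ^ 4) : (a - a ^ 3) * (b - b ^ 3) = 0 := by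
  linear_combination h + (a ^ 3 - b) * pow_nine_eq_self h9 a +
    (a ^ 3 * b - 2 * a ^ 2 * b ^ 2 + a * b ^ 3 - a ^ 9 * b + 2 * a ^ 6 * b ^ 2 - a ^ 3 * b ^ 3) * h3

theorem tripleInvariant_zero_infinity_affine (h9 : Nat.card K = 9) (a : K) :
    tripleInvariant (affinePoint 0) (infinityPoint K) (affinePoint a) = a ^ 4 := by
  refine (tripleInvariant_mk h9 _ _ _).trans ?_
  simp [tripleDet, pairDet]
  try ring

theorem tripleInvariant_infinity_affine_affine (h9 : Nat.card K = 9) (a b : K) :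
    tripleInvariant (infinityPoint K) (affinePoint a) (affinePoint b) = (b - a) ^ 4 := by
  refine (tripleInvariant_mk h9 _ _ _).trans ?_
  simp [tripleDet, pairDet]
  try ring

theorem tripleInvariant_infinity_affine_infinity (h9 : Nat.card K = 9) (a : K) :
    tripleInvariant (infinityPoint K) (affinePoint a) (infinityPoint K) = 0 := by
  refine (tripleInvariant_mk h9 _ _ _).trans ?_
  simp [tripleDet, pairDet]

theorem tripleInvariant_zero_infinity_infinity (h9 : Nat.card K = 9) :
    tripleInvariant (affinePoint 0) (infinityPoint K) (infinityPoint K) = 0 := by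
  refine (tripleInvariant_mk h9 _ _ _).trans ?_
  simp [tripleDet, pairDet]

theorem exists_fieldAut_smul_eq (h9 : Nat.card K = 9) {ι : Type*} {X Z : ι → ℙ K (Fin 2 → K)}
    (h : ∀ i j l, tripleInvariant (X i) (X j) (X l) = tripleInvariant (Z i) (Z j) (Z l))
    {i₁ i₂ i₃ : ι} (hX₁ : X i₁ = affinePoint 0) (hX₂ : X i₂ = infinityPoint K)
    (hX₃ : X i₃ = affinePoint 1) (hZ₁ : Z i₁ = affinePoint 0) (hZ₂ : Z i₂ = infinityPoint K)
    (hZ₃ : Z i₃ = affinePoint 1) :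
    ∃ ρ : K ≃+* K, ∀ i, fieldAutToGammaL K 2 ρ • X i = Z i := by
  obtain ⟨hchar, -⟩ := charP_three_of_card_eq_nine h9
  have h3 : (3 : K) = 0 := by exact_mod_cast CharP.cast_eq_zero K 3
  have key : ∀ i, (X i = infinityPoint K ∧ Z i = infinityPoint K) ∨
      ∃ a b, X i = affinePoint a ∧ Z i = affinePoint b ∧ (b = a ∨ b = a ^ 3) := by
    intro i
    have h1 := h i₁ i₂ i
    have h2 := h i₂ i₃ i
    rw [hX₁, hX₂, hZ₁, hZ₂] at h1
    rw [hX₃, hX₂, hZ₃, hZ₂] at h2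
    rcases eq_infinityPoint_or_affinePoint (X i) with hx | ⟨a, hx⟩ <;>
      rcases eq_infinityPoint_or_affinePoint (Z i) with hz | ⟨b, hz⟩
    · exact Or.inl ⟨hx, hz⟩
    · rw [hx, hz, tripleInvariant_zero_infinity_affine h9,
        tripleInvariant_zero_infinity_infinity h9] at h1
      rw [hx, hz, tripleInvariant_infinity_affine_affine h9,
        tripleInvariant_infinity_affine_infinity h9, pow_eq_zero_iff four_ne_zero |>.mp h1.symm] at h2
      norm_num at h2
    · rw [hx, hz, tripleInvariant_zero_infinity_affine h9,
        tripleInvariant_zero_infinity_infinity h9] at h1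
      rw [hx, hz, tripleInvariant_infinity_affine_affine h9,
        tripleInvariant_infinity_affine_infinity h9, pow_eq_zero_iff four_ne_zero |>.mp h1] at h2
      norm_num at h2
    · rw [hx, hz, tripleInvariant_zero_infinity_affine h9,
        tripleInvariant_zero_infinity_affine h9] at h1
      rw [hx, hz, tripleInvariant_infinity_affine_affine h9,
        tripleInvariant_infinity_affine_affine h9] at h2
      exact Or.inr ⟨a, b, hx, hz, eq_or_eq_pow_three h3 h1 h2⟩
  by_cases H : ∀ i, X i = Z i
  · refine ⟨1, fun i => ?_⟩
    rw [map_one, one_smul, H]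
  -- Once some coordinate is genuinely moved by Frobenius, comparing with it shows that every
  -- unmoved coordinate is Frobenius-fixed, so Frobenius serves for all indices.
  push Not at H
  obtain ⟨i, hi⟩ := H
  have : Fact (Nat.Prime 3) := ⟨Nat.prime_three⟩
  refine ⟨frobeniusEquiv K 3, fun j => ?_⟩
  rcases key j with ⟨hx, hz⟩ | ⟨a', b', hx, hz, hab'⟩
  · rw [hx, hz, fieldAut_smul_infinityPoint]
  rw [hx, hz, fieldAut_smul_affinePoint, frobeniusEquiv_apply, frobenius_def]
  congr 1
  rcases hab' with rfl | rfl
  swap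
  · rfl
  rcases key i with ⟨hx', hz'⟩ | ⟨a, b, hx', hz', hab⟩
  · exact absurd (hx'.trans hz'.symm) hi
  rcases hab with rfl | rfl
  · exact absurd (hx'.trans hz'.symm) hi
  have h1 := h i₂ j i
  rw [hX₂, hZ₂, hx, hz, hx', hz', tripleInvariant_infinity_affine_affine h9,
    tripleInvariant_infinity_affine_affine h9] at h1
  rcases mul_eq_zero.mp (mul_eq_zero_of_pow_four_eq h3 h9 h1) with h0 | h0
  · refine absurd ?_ hi
    rw [hx', hz', ← sub_eq_zero.mp h0]
  · exact (sub_eq_zero.mp h0).symm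

theorem relationalComplexity_PSigmaL_le_three (h9 : Nat.card K = 9) :
    relationalComplexity (PSigmaL K 2) (ℙ K (Fin 2 → K)) ≤ 3 := by
  obtain ⟨hchar, -⟩ := charP_three_of_card_eq_nine h9
  have hneg := neg_one_ne_one_of_charP_three (K := K)
  refine relationalComplexity_le 3 (by norm_num) fun k hk X Y hXY => ?_
  have hsub : ∀ I : Finset (Fin k), I.card ≤ 3 → ∃ g : PSigmaL K 2, ∀ i ∈ I, g • X i = Y i :=
    fun I hI => hXY.exists_smul_eq hk I hI
  by_cases H : ∃ i j l, X i ≠ X j ∧ X j ≠ X l ∧ X i ≠ X l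
  · obtain ⟨i₁, i₂, i₃, h12, h23, h13⟩ := H
    obtain ⟨g, hg⟩ := hsub {i₁, i₂, i₃} Finset.card_le_three
    obtain ⟨P, ⟨c₁, hP₁⟩, ⟨c₂, hP₂⟩, c₃, hP₃⟩ := exists_linear_frame h12 h23 h13
    set p : GammaL K (Fin 2 → K) := linearToGammaL K _ P with hp
    have hframe : ∀ {v : Fin 2 → K} (hv : v ≠ 0) {c : K} {q : ℙ K (Fin 2 → K)},
        P v = c • q.rep → p⁻¹ • q = Projectivization.mk K v hv := by
      intro v hv c q hc
      rw [inv_smul_eq_iff, gammaL_smul_mk]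
      conv_lhs => rw [← q.mk_rep]
      symm
      rw [Projectivization.mk_eq_mk_iff']
      exact ⟨c, hc.symm⟩
    set Z : Fin k → ℙ K (Fin 2 → K) := fun i => g⁻¹ • Y i with hZ
    have hXZ : ∀ i ∈ ({i₁, i₂, i₃} : Finset (Fin k)), Z i = X i := fun i hi => by
      rw [hZ, inv_smul_eq_iff, hg i hi]
    have hinv : ∀ i j l,
        tripleInvariant (X i) (X j) (X l) = tripleInvariant (Z i) (Z j) (Z l) := by
      intro i j l
      obtain ⟨g', hg'⟩ := hsub {i, j, l} Finset.card_le_three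
      have e : ∀ m ∈ ({i, j, l} : Finset (Fin k)),
          Z m = ((g⁻¹ * g' : PSigmaL K 2) : PGammaL K (Fin 2 → K)) • X m := fun m hm => by
        change g⁻¹ • Y m = (g⁻¹ * g') • X m
        rw [mul_smul, hg' m hm]
      rw [e i (by simp), e j (by simp), e l (by simp),
        tripleInvariant_smul_of_mem h9 (g⁻¹ * g').2]
    obtain ⟨ρ, hρ⟩ := exists_fieldAut_smul_eq h9 (X := fun i => p⁻¹ • X i)
      (Z := fun i => p⁻¹ • Z i) (i₁ := i₁) (i₂ := i₂) (i₃ := i₃)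
      (fun i j l => by rw [tripleInvariant_smul h9, tripleInvariant_smul h9, hinv])
      (hframe _ hP₁) (hframe _ hP₂) (hframe _ hP₃)
      (by rw [hXZ i₁ (by simp)]; exact hframe _ hP₁)
      (by rw [hXZ i₂ (by simp)]; exact hframe _ hP₂)
      (by rw [hXZ i₃ (by simp)]; exact hframe _ hP₃)
    -- `g` matches the chosen triple, and the conjugated automorphism, which fixes that triple,
    -- corrects all remaining points.
    refine ⟨g * ⟨_, conj_fieldAut_mem_PSigmaL hneg P ρ⟩, fun i => ?_⟩
    rw [mul_smul, ← eq_inv_smul_iff]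
    change (p * fieldAutToGammaL K 2 ρ * p⁻¹) • X i = Z i
    rw [mul_smul, mul_smul, hρ i, smul_inv_smul]
  -- At most two distinct points occur, so matching representatives of them suffices; `hpair` shows
  -- that `Y` repeats wherever `X` does.
  · push Not at H
    obtain ⟨i₀⟩ : Nonempty (Fin k) := ⟨⟨0, by omega⟩⟩
    have hpair : ∀ i j, X i = X j → Y i = Y j := by
      intro i j hij
      obtain ⟨g, hg⟩ := hsub {i, j} (Finset.card_le_two.trans (by norm_num))
      rw [← hg i (by simp), ← hg j (by simp), hij]
    by_cases hc : ∀ i, X i = X i₀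
    · obtain ⟨g, hg⟩ := hsub {i₀} (by simp)
      exact ⟨g, fun i => by rw [hc i, hg i₀ (by simp), hpair i i₀ (hc i)]⟩
    · push Not at hc
      obtain ⟨i₁, hi₁⟩ := hc
      obtain ⟨g, hg⟩ := hsub {i₀, i₁} (Finset.card_le_two.trans (by norm_num))
      refine ⟨g, fun i => ?_⟩
      by_cases hi : X i = X i₀
      · rw [hi, hg i₀ (by simp), hpair i i₀ hi]
      · have := H i i₀ i₁ hi hi₁.symm
        rw [this, hg i₁ (by simp), hpair i i₁ this]

/-- The triples `0, ∞, 1` and `0, ∞, ζ` agree on pairs, but for a nonsquare `ζ` the triple invariant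
distinguishes them. -/
theorem three_le_relationalComplexity_PSigmaL (h9 : Nat.card K = 9) :
    3 ≤ relationalComplexity (PSigmaL K 2) (ℙ K (Fin 2 → K)) := by
  obtain ⟨ζ, hζ0, hζ⟩ : ∃ ζ : K, ζ ≠ 0 ∧ ζ ^ 4 ≠ 1 := by
    obtain ⟨g, hg⟩ := IsCyclic.exists_ofOrder_eq_natCard (α := Kˣ)
    refine ⟨g, g.ne_zero, fun h => ?_⟩
    have h8 : Nat.card Kˣ = 8 := by rw [Nat.card_units, h9]
    have := orderOf_dvd_of_pow_eq_one (x := g) (n := 4) (by ext; push_cast; exact h)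
    rw [hg, h8] at this
    omega
  have hmem : ∀ (M : Matrix (Fin 2) (Fin 2) K) {c : K}, c ≠ 0 → M.det = c ^ 2 →
      ∃ f : GammaL K (Fin 2 → K), (f : PGammaL K (Fin 2 → K)) ∈ PSigmaL K 2 ∧
        ∀ v, f.1 v = M.mulVec v := by
    intro M c hc hM
    have hdet : LinearMap.det (Matrix.toLin' M) = c ^ 2 := (LinearMap.det_toLin' M).trans hM
    refine ⟨linearToGammaL K _ (LinearMap.equivOfDetNeZero (Matrix.toLin' M)
      (by rw [hdet]; exact pow_ne_zero 2 hc)), ?_, fun v => rfl⟩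
    exact Subgroup.map_mono le_sup_left (linear_mem_PSL _ hc hdet)
  have hv : ∀ b : K, (![1, b] : Fin 2 → K) ≠ 0 := fun b h => one_ne_zero (congrFun h 0)
  have hw : (![0, 1] : Fin 2 → K) ≠ 0 := fun h => one_ne_zero (congrFun h 1)
  have key := card_le_relationalComplexity_of_vectors (PSigmaL K 2)
    (![![1, 0], ![0, 1], ![1, 1]] : Fin 3 → Fin 2 → K) ![![1, 0], ![0, 1], ![1, ζ]]
    (fun i => by fin_cases i <;> first | exact hv _ | exact hw)
    (fun i => by fin_cases i <;> first | exact hv _ | exact hw)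
    (fun i₀ => by
      match i₀ with
      | 0 =>
        obtain ⟨f, hf, hfM⟩ := hmem !![1, 0; ζ - 1, 1] one_ne_zero
          (by rw [Matrix.det_fin_two_of]; ring)
        refine ⟨f, hf, fun i hi => ?_⟩
        match i with
        | 0 => exact absurd rfl hi
        | 1 => exact ⟨1, (hfM _).trans (mulVec_fin_two_eq_smul (by ring) (by ring))⟩
        | 2 => exact ⟨1, (hfM _).trans (mulVec_fin_two_eq_smul (by ring) (by ring))⟩
      | 1 =>
        obtain ⟨f, hf, hfM⟩ := hmem !![ζ, 1 - ζ; 0, ζ] hζ0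
          (by rw [Matrix.det_fin_two_of]; ring)
        refine ⟨f, hf, fun i hi => ?_⟩
        match i with
        | 0 => exact ⟨ζ, (hfM _).trans (mulVec_fin_two_eq_smul (by ring) (by ring))⟩
        | 1 => exact absurd rfl hi
        | 2 => exact ⟨1, (hfM _).trans (mulVec_fin_two_eq_smul (by ring) (by ring))⟩
      | 2 =>
        refine ⟨1, one_mem _, fun i hi => ⟨1, ?_⟩⟩
        rw [one_smul]
        match i with
        | 0 => rfl
        | 1 => rfl
        | 2 => exact absurd rfl hi)
    (fun f hf h => by
      have e : ∀ {x y : Fin 2 → K} (hx : x ≠ 0) (hy : y ≠ 0), (∃ c : K, f.1 x = c • y) →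
          (f : PGammaL K (Fin 2 → K)) • Projectivization.mk K x hx = Projectivization.mk K y hy :=
        fun hx hy h => (mk_smul_mk_eq_iff f hx hy).mpr h
      have hinv := tripleInvariant_smul_of_mem h9 hf (affinePoint 0) (infinityPoint K)
        (affinePoint 1)
      have e₁ : (f : PGammaL K (Fin 2 → K)) • affinePoint (0 : K) = affinePoint 0 := e _ _ (h 0)
      have e₂ : (f : PGammaL K (Fin 2 → K)) • infinityPoint K = infinityPoint K := e _ _ (h 1)
      have e₃ : (f : PGammaL K (Fin 2 → K)) • affinePoint (1 : K) = affinePoint ζ := e _ _ (h 2)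
      rw [e₁, e₂, e₃] at hinv
      refine hζ ((tripleInvariant_zero_infinity_affine h9 ζ).symm.trans (hinv.trans ?_))
      exact (tripleInvariant_zero_infinity_affine h9 1).trans (one_pow 4))
  simpa using key

theorem relationalComplexity_PSigmaL_eq_three (h9 : Nat.card K = 9) :
    relationalComplexity (PSigmaL K 2) (ℙ K (Fin 2 → K)) = 3 :=
  (relationalComplexity_PSigmaL_le_three h9).antisymm (three_le_relationalComplexity_PSigmaL h9)

end NineElements

theorem one_lt_card_ringAut_of_one_lt_relIndex {K : Type*} [Field K] [Finite K] {n : ℕ} [NeZero n]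
    {G : Subgroup (PGammaL K (Fin n → K))} (h : 1 < (PGL K (Fin n → K)).relIndex G) :
    1 < Nat.card (K ≃+* K) := by
  have : Finite (K ≃+* K) := finite_ringAut
  rw [← ker_pGammaAut, Subgroup.relIndex_ker] at h
  exact h.trans_le (Nat.card_le_card_of_injective _ Subtype.val_injective)

theorem theoremB {K : Type*} [Field K] [Finite K] (n : ℕ)
    (G : Subgroup (PGammaL K (Fin n → K)))
    (hG : PSL K (Fin n → K) ≤ G)
    (e : ℕ) (he : e = (PGL K (Fin n → K)).relIndex G) (he1 : 1 < e) :
    (n = 2 → 8 ≤ Nat.card K →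
      (Nat.card K = 9 ∧ G = PSigmaL K n →
        relationalComplexity G (ℙ K (Fin n → K)) = 3) ∧
      (¬ (Nat.card K = 9 ∧ G = PSigmaL K n) →
        4 ≤ relationalComplexity G (ℙ K (Fin n → K)) ∧
        relationalComplexity G (ℙ K (Fin n → K)) ≤
          ((4 + ArithmeticFunction.cardDistinctFactors e : ℕ) : ℕ∞))) ∧
    (3 ≤ n →
      relationalComplexity G (ℙ K (Fin n → K)) ≤
        ((2 * n - 1 + ArithmeticFunction.cardDistinctFactors e : ℕ) : ℕ∞) ∧
      ((n + 2 : ℕ) : ℕ∞) ≤ relationalComplexity G (ℙ K (Fin n → K)) ∧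
      (PGL K (Fin n → K) < G →
        ((n + 3 : ℕ) : ℕ∞) ≤ relationalComplexity G (ℙ K (Fin n → K))) ∧
      (G ≤ PSigmaL K n → PSigmaL K n ≠ ⊤ →
        ((2 * n - 2 : ℕ) : ℕ∞) ≤ relationalComplexity G (ℙ K (Fin n → K)))) := by
  subst he
  have hGe : ¬ G ≤ PGL K (Fin n → K) := fun h => he1.ne' (Subgroup.relIndex_eq_one.mpr h)
  refine ⟨?_, fun hn => ?_⟩
  · rintro rfl h8
    have hAut := one_lt_card_ringAut_of_one_lt_relIndex he1
    refine ⟨?_, fun hne => ⟨four_le_relationalComplexity h8 hAut hG hne,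
      relationalComplexity_le_two_mul G⟩⟩
    rintro ⟨h9, rfl⟩
    exact relationalComplexity_PSigmaL_eq_three h9
  · have : NeZero n := ⟨by omega⟩
    have hadd : PGL K (Fin n → K) ≤ G →
        ((n + 3 : ℕ) : ℕ∞) ≤ relationalComplexity G (ℙ K (Fin n → K)) :=
      add_three_le_relationalComplexity hn hGe
    refine ⟨relationalComplexity_le_two_mul_sub_one hn G, ?_, fun h => hadd h.le,
      fun h hne => two_mul_sub_two_le_relationalComplexity hn hG h hne⟩
    by_cases h4 : 4 ≤ n
    · exact add_two_le_relationalComplexity_of_four_le h4 hGe hG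
    obtain rfl : n = 3 := by omega
    -- Containing `PGL` gives even `n + 3 = 6`; otherwise the five-point tuples give `n + 2 = 5`.
    rcases PGL_le_or_five_le_relationalComplexity hG with h | h
    · exact le_trans (by exact_mod_cast Nat.le_succ _) (hadd h)
    · exact h
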